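/- Let $G$ be a simply connected compact semisimple Lie group with Lie algebra $\mathfrak g$, $T\subset G$ a maximal torus with Lie algebra $\mathfrak t$, and $\alpha_1,\dots,\alpha_n$ a system of positive roots, viewed as (imaginary-valued) functionals on $\mathfrak t$. Let $g_0$ be minus the Killing form, extended complex bilinearly to $\mathfrak g\otimes\mathbb C$. For a functional $\lambda:\mathfrak t\to\mathbb C$ let $H_\lambda\in\mathfrak t\otimes\mathbb C$ be its dual, $g_0(H_\lambda,H)=\lambda(H)$ for $H\in\mathfrak t$; put $g_0(\lambda,\nu)=g_0(H_\lambda,H_\nu)$ and $\|\lambda\|^2=g_0(\lambda,\lambda)$ (complex bilinear, hence negative on nonzero real combinations of roots), $H_\alpha$ for $\lambda=\alpha$, and $\rho=\frac12\sum_{\alpha>0}\alpha$. Choose a $g_0$-orthonormal basis $\{E_\alpha,F_\alpha\}_{\alpha>0}$ of $\mathfrak t^\perp$ such that $Z_\alpha=\frac12(E_\alpha-iF_\alpha)$ and $\bar Z_\alpha=\frac12(E_\alpha+iF_\alpha)$ are root vectors for $\alpha$ and $-\alpha$. Let $\sigma$ be the canonical quantization on functions on $\mathbb R^n$: $\sigma(E_{\alpha_j})=ix_j$,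 $\sigma(F_{\alpha_j})=\partial/\partial x_j$, extended complex linearly to $\mathfrak t^\perp\otimes\mathbb C$. For $H\in\mathfrak t$ let $$m_*(\mathrm{ad}_H)=-\tfrac12\sum_j\alpha_j(H)\bigl(\sigma(E_{\alpha_j})^2+\sigma(F_{\alpha_j})^2\bigr)$$ be the metaplectic representation, and for $l\ge 0$ let $E_l^0$ be the span of the Hermite functions $h_{\beta_1}(x_1)\cdots h_{\beta_n}(x_n)$ with $\beta_1+\dots+\beta_n=l$, where $h_m(t)=e^{t^2/2}\frac{d^m}{dt^m}e^{-t^2}$. Let $\mu$ be a weight of $T$. The smooth sections of the metaplectic spinor bundle $S$ over $G/T$ twisted by the line bundle $L_{\mu-\rho}$ are identified with the smooth functions $\phi$ from $G$ to the Schwartz space of $\mathbb R^n$ such that $$\phi(ge^{H})=e^{-(\mu-\rho)(H)}\,e^{-m_*(\mathrm{ad}_H)}\phi(g)\qquad(g\in G,\ H\in\mathfrak t),$$ and the sections of $E_l$ are those with values in $E_l^0$. Elements of $\mathfrak g\otimes\mathbb C$ act on such $\phi$ by differentiation along left-invariant vector fields. Let $$D=\sum_{\alpha>0}(\sigma(E_\alpha)F_\alpha-\sigma(F_\alpha)E_\alpha),\qquad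 \tilde D=\sum_{\alpha>0}(\sigma(E_\alpha)E_\alpha+\sigma(F_\alpha)F_\alpha)$$ be the symplectic Dirac operators (for the canonical connection), $\mathscr D_\mu=D+i\tilde D$, $\bar{\mathscr D}_\mu=D-i\tilde D$, acting on sections twisted by $L_{\mu-\rho}$, and $P_\mu=\frac12[\mathscr D_\mu,\bar{\mathscr D}_\mu]$. Let $\Omega_{\mathfrak g}=\sum_i X_i^2$ and $\Omega_{\mathfrak t}=\sum_j h_j^2$ be the Casimir operators, for $g_0$-orthonormal bases $\{X_i\}$ of $\mathfrak g$ and $\{h_j\}$ of $\mathfrak t$. Then, on all smooth sections of the twisted spinor bundle (in particular on sections of each $E_l$), $$P_\mu=-\Omega_{\mathfrak g}+\Omega_{\mathfrak t}+2\sum_{\alpha>0}\bigl(\sigma(Z_\alpha)\sigma(\bar Z_\alpha)+\sigma(\bar Z_\alpha)\sigma(Z_\alpha)\bigr)H_\alpha-8\sum_{\substack{\alpha,\beta>0\\ \alpha\ne\beta}}\sigma(Z_\alpha)\sigma(\bar Z_\beta)[\bar Z_\alpha,Z_\beta],$$ and on sections of $E_0$ $$P_\mu|_{E_0}=-\Omega_{\mathfrak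 g}+\|\mu\|^2+2g_0(\rho,\mu)=-\Omega_{\mathfrak g}+\|\mu+\rho\|^2-\|\rho\|^2 .$$ -/

import Mathlib

open scoped Manifold ContDiff TensorProduct

namespace FlagDirac

noncomputable section

/-! ### The Lie algebra, the metric and left-invariant derivatives -/

section Group

variable (d : ℕ) (G : Type*) [TopologicalSpace G] [ChartedSpace (EuclideanSpace ℝ (Fin d)) G]
  [Group G] [LieGroup (𝓡 d) ∞ G]

instance (d : ℕ) (G : Type*) [TopologicalSpace G] [ChartedSpace (EuclideanSpace ℝ (Fin d)) G]
    [Group G] [LieGroup (𝓡 d) ∞ G] : LieGroup (𝓡 d) (minSmoothness ℝ 3) G :=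
  LieGroup.of_le (n := ∞) (by rw [minSmoothness_of_isRCLikeNormedField]; exact ENat.LEInfty.out)

/-- The Lie algebra `𝔤` of `G` (tangent space at `1` with the bracket of left-invariant vector
fields). -/
abbrev LieAlg : Type := GroupLieAlgebra (𝓡 d) G

/-- The complexification `𝔤 ⊗ ℂ`. -/
abbrev LieAlgC : Type := ℂ ⊗[ℝ] LieAlg d G

/-- `g₀`, minus the Killing form of `𝔤`. -/
def g0 : LinearMap.BilinForm ℝ (LieAlg d G) := -killingForm ℝ (LieAlg d G)

/-- The complex bilinear extension of `g₀` to `𝔤 ⊗ ℂ`. -/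
def g0C : LinearMap.BilinForm ℂ (LieAlgC d G) := (g0 d G).baseChange ℂ

end Group

section Group

variable {d : ℕ} {G : Type*} [TopologicalSpace G] [ChartedSpace (EuclideanSpace ℝ (Fin d)) G]
  [Group G] [LieGroup (𝓡 d) ∞ G]

/-- The inclusion `𝔤 → 𝔤 ⊗ ℂ`. -/
def toC (X : LieAlg d G) : LieAlgC d G := (1 : ℂ) ⊗ₜ[ℝ] X

/-- `γ` is the one-parameter subgroup `s ↦ exp (s X)`: the integral curve through `1` of the
left-invariant vector field determined by `X`. -/
def IsExpCurve (X : LieAlg d G) (γ : ℝ → G) : Prop :=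
  γ 0 = 1 ∧ IsMIntegralCurve (I := 𝓡 d) γ (mulInvariantVectorField X)

/-- A torus in `G`: a compact connected abelian subgroup. -/
def IsTorus (T : Subgroup G) : Prop :=
  IsCompact (T : Set G) ∧ IsConnected (T : Set G) ∧ ∀ x ∈ T, ∀ y ∈ T, x * y = y * x

/-- A maximal torus of `G`. -/
def IsMaximalTorus (T : Subgroup G) : Prop := Maximal IsTorus T

/-- The Lie algebra `𝔱` of a closed subgroup `T`: all `X` with `exp (s X) ∈ T` for all `s`
(these `X` already form a subspace; taking the span only packages this). -/
def lieOf (T : Subgroup G) : Submodule ℝ (LieAlg d G) :=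
  Submodule.span ℝ {X | ∃ γ : ℝ → G, IsExpCurve X γ ∧ ∀ s, γ s ∈ T}

/-- The orthogonal complement `𝔱^⊥` with respect to `g₀`. -/
def lieOfPerp (T : Subgroup G) : Submodule ℝ (LieAlg d G) :=
  (g0 d G).orthogonal (lieOf T)

/-- `ℂ`-valued real-linear functionals on `𝔱`, i.e. elements of `(𝔱 ⊗ ℂ)^*`. -/
abbrev Functional (T : Subgroup G) : Type := lieOf (d := d) T →ₗ[ℝ] ℂ

/-- `μ` is a weight of `T`: the differential of a continuous character of `T`. -/
def IsWeight (T : Subgroup G) (μ : Functional (d := d) T) : Prop :=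
  ∃ χ : T →* Circle, Continuous χ ∧
    ∀ (H : lieOf (d := d) T) (γ : ℝ → G) (_ : IsExpCurve (H : LieAlg d G) γ)
      (hT : ∀ s, γ s ∈ T) (s : ℝ), (χ ⟨γ s, hT s⟩ : ℂ) = Complex.exp (s * μ H)

/-- `Z ∈ 𝔤 ⊗ ℂ` is a root vector for `α`: `Z ≠ 0` and `[H, Z] = α(H) Z` for `H ∈ 𝔱`. -/
def IsRootVector (T : Subgroup G) (α : Functional (d := d) T) (Z : LieAlgC d G) : Prop :=
  Z ≠ 0 ∧ ∀ H : lieOf (d := d) T, ⁅toC (H : LieAlg d G), Z⁆ = α H • Z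

/-- `α` is a root of `(G, T)`. -/
def IsRoot (T : Subgroup G) (α : Functional (d := d) T) : Prop :=
  α ≠ 0 ∧ ∃ Z : LieAlgC d G, IsRootVector T α Z

/-- `α 0, …, α (n-1)` is an enumeration without repetition of a system of positive roots. -/
structure IsPositiveSystem (T : Subgroup G) {n : ℕ} (α : Fin n → Functional (d := d) T) :
    Prop where
  injective : Function.Injective α
  isRoot : ∀ j, IsRoot T (α j)
  exhaust : ∀ β, IsRoot T β → β ∈ Set.range α ∨ -β ∈ Set.range α
  disjoint : ∀ i j, α i ≠ -α j
  add_mem : ∀ i j, IsRoot T (α i + α j) → α i + α j ∈ Set.range α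

/-- `ρ`, half the sum of the positive roots. -/
def rho {T : Subgroup G} {n : ℕ} (α : Fin n → Functional (d := d) T) : Functional (d := d) T :=
  (1 / 2 : ℝ) • ∑ j, α j

/-- `Z_j = (E_j - i F_j) / 2`. -/
def Zvec {n : ℕ} (E F : Fin n → LieAlg d G) (j : Fin n) : LieAlgC d G :=
  (1 / 2 : ℂ) • (toC (E j) - Complex.I • toC (F j))

/-- `Z̄_j = (E_j + i F_j) / 2`. -/
def Zbar {n : ℕ} (E F : Fin n → LieAlg d G) (j : Fin n) : LieAlgC d G :=
  (1 / 2 : ℂ) • (toC (E j) + Complex.I • toC (F j))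

/-- `{E_j, F_j}` is a `g₀`-orthonormal basis of `𝔱^⊥` such that `Z_j` and `Z̄_j` are root vectors
for `α_j` and `-α_j`. -/
structure IsRootFrame (T : Subgroup G) {n : ℕ} (α : Fin n → Functional (d := d) T)
    (E F : Fin n → LieAlg d G) : Prop where
  EE : ∀ i j, g0 d G (E i) (E j) = if i = j then 1 else 0
  FF : ∀ i j, g0 d G (F i) (F j) = if i = j then 1 else 0
  EF : ∀ i j, g0 d G (E i) (F j) = 0
  span_eq : Submodule.span ℝ (Set.range E ∪ Set.range F) = lieOfPerp T
  rootZ : ∀ j, IsRootVector T (α j) (Zvec E F j)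
  rootZbar : ∀ j, IsRootVector T (-α j) (Zbar E F j)

/-- The vector `H_λ ∈ 𝔱 ⊗ ℂ` dual to `λ`, i.e. `g₀(H_λ, H) = λ(H)` for `H ∈ 𝔱`, computed in a
`g₀`-orthonormal basis `h` of `𝔱`. -/
def dualVec {T : Subgroup G} {k : ℕ} (h : Module.Basis (Fin k) ℝ (lieOf (d := d) T))
    (l : Functional (d := d) T) : LieAlgC d G :=
  ∑ i, l (h i) • toC (h i : LieAlg d G)

/-- The complex bilinear form `g₀(λ, ν) = g₀(H_λ, H_ν)` on `(𝔱 ⊗ ℂ)^*`.  It is negative definite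
on the real span of the weights, which take imaginary values on `𝔱`. -/
def weightForm {T : Subgroup G} {k : ℕ} (h : Module.Basis (Fin k) ℝ (lieOf (d := d) T))
    (l ν : Functional (d := d) T) : ℂ :=
  g0C d G (dualVec h l) (dualVec h ν)

/-! ### Spinors

Spinor fields are functions `Φ : G → (ℝⁿ → ℂ)`. -/

/-- Complex functions on `ℝⁿ`. -/
abbrev Fun (n : ℕ) : Type := EuclideanSpace ℝ (Fin n) → ℂ

/-- Canonical quantization for the unitary basis `{E_j, F_j}` of `𝔱^⊥`: `σ(E_j) = i x_j` and
`σ(F_j) = ∂/∂x_j`, extended complex linearly. -/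
def sigma {n : ℕ} (E F : Fin n → LieAlg d G) (v : LieAlgC d G) (ψ : Fun n) : Fun n := fun x =>
  ∑ j, (g0C d G v (toC (E j)) * (Complex.I * (x j : ℂ) * ψ x) +
    g0C d G v (toC (F j)) * fderiv ℝ ψ x (EuclideanSpace.single j 1))

/-- The fibrewise action of `σ(v)` on spinor fields. -/
def sig {n : ℕ} (E F : Fin n → LieAlg d G) (v : LieAlgC d G) (Φ : G → Fun n) : G → Fun n :=
  fun g => sigma E F v (Φ g)

/-- For fixed `Φ`, `g`, `x`: the derivative at `g` of `Φ(·)(x)` in the direction of the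
left-invariant vector field `X`, as a linear function of `X`. -/
def derivAt {n : ℕ} (Φ : G → Fun n) (g : G) (x : EuclideanSpace ℝ (Fin n)) :
    LieAlg d G →ₗ[ℝ] ℂ where
  toFun X := (mfderiv (𝓡 d) 𝓘(ℝ, ℂ) (fun g' => Φ g' x) g (mulInvariantVectorField X g) : ℂ)
  map_add' X Y := by
    rw [mulInvariantVectorField_add]
    exact map_add (mfderiv (𝓡 d) 𝓘(ℝ, ℂ) (fun g' => Φ g' x) g) _ _
  map_smul' c X := by
    rw [mulInvariantVectorField_smul]
    exact map_smul (mfderiv (𝓡 d) 𝓘(ℝ, ℂ) (fun g' => Φ g' x) g) _ _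

/-- `X · Φ` for `X ∈ 𝔤 ⊗ ℂ`: differentiation along the left-invariant (complex) vector field `X`.
For `X ∈ 𝔱^⊥` this is also the canonical connection `∇_X` on sections over `G/T`. -/
def lieD {n : ℕ} (X : LieAlgC d G) (Φ : G → Fun n) : G → Fun n := fun g x =>
  (derivAt Φ g x).liftBaseChange ℂ X

/-- The Hermite function `h_m(t) = e^{t²/2} (d/dt)^m e^{-t²}`. -/
def hermite (m : ℕ) (t : ℝ) : ℝ :=
  Real.exp (t ^ 2 / 2) * iteratedDeriv m (fun u => Real.exp (-u ^ 2)) t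

/-- `h_β(x) = h_{β_1}(x_1) ⋯ h_{β_n}(x_n)`. -/
def hermiteFn {n : ℕ} (β : Fin n → ℕ) : Fun n := fun x => ((∏ j, hermite (β j) (x j) : ℝ) : ℂ)

/-- `E_l^0`, the span of the `h_β` with `β_1 + ⋯ + β_n = l`. -/
def Efib (n l : ℕ) : Submodule ℂ (Fun n) :=
  Submodule.span ℂ {ψ | ∃ β : Fin n → ℕ, ∑ j, β j = l ∧ ψ = hermiteFn β}

/-- `m_*(ad H)` for `H ∈ 𝔱`, where `m_* = -i σ` on quadratic elements of the Weyl algebra.  As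
`[H, E_j] = -i α_j(H) F_j` and `[H, F_j] = i α_j(H) E_j`, the quadratic element corresponding to
`ad H` is `½ ∑_j (-i α_j(H)) (E_j² + F_j²)`. -/
def metaAd {T : Subgroup G} {n : ℕ} (α : Fin n → Functional (d := d) T)
    (E F : Fin n → LieAlg d G) (H : lieOf (d := d) T) (ψ : Fun n) : Fun n :=
  -Complex.I • ((1 / 2 : ℂ) • ∑ j, (-Complex.I * α j H) •
    (sigma E F (toC (E j)) (sigma E F (toC (E j)) ψ) +
      sigma E F (toC (F j)) (sigma E F (toC (F j)) ψ)))

/-- Smooth sections of the metaplectic spinor bundle of `G/T` (with typical fibre the Schwartz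
space of `ℝⁿ`) twisted by the line bundle `L_{μ-ρ}`, viewed as equivariant functions on `G`.

* `smooth`, `decay`: `Φ` is a smooth function from the compact group `G` to the Schwartz space.
* `equivariant`: `Φ(gt) = χ_{μ-ρ}(t)⁻¹ m(Ad~ t)⁻¹ Φ(g)` for `t = exp(sH) ∈ T`.  Here
  `m(Ad~ exp(sH)) = e^{s m_*(ad H)}` is the unitary operator on `L²(ℝⁿ)` that multiplies an
  eigenfunction of the skew-adjoint operator `m_*(ad H)` (whose Schwartz eigenfunctions span a
  dense subspace) of eigenvalue `c` by `e^{sc}`; so the condition says that the `L²` products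
  with each such eigenfunction `θ` agree. -/
structure IsSection (T : Subgroup G) {n : ℕ} (α : Fin n → Functional (d := d) T)
    (E F : Fin n → LieAlg d G) (μ : Functional (d := d) T) (Φ : G → Fun n) : Prop where
  smooth : ContMDiff ((𝓡 d).prod (𝓡 n)) 𝓘(ℝ, ℂ) ∞
    (fun p : G × EuclideanSpace ℝ (Fin n) => Φ p.1 p.2)
  decay : ∀ (L : List (LieAlg d G)) (k m : ℕ), ∃ C : ℝ, ∀ g x,
    ‖x‖ ^ k * ‖iteratedFDeriv ℝ m (L.foldr (fun X Ψ => lieD (toC X) Ψ) Φ g) x‖ ≤ C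
  equivariant : ∀ (H : lieOf (d := d) T) (γ : ℝ → G), IsExpCurve (H : LieAlg d G) γ →
    (∀ s, γ s ∈ T) → ∀ (θ : SchwartzMap (EuclideanSpace ℝ (Fin n)) ℂ) (c : ℂ),
      metaAd α E F H θ = c • (θ : Fun n) → ∀ (g : G) (s : ℝ),
        ∫ x, starRingEnd ℂ (θ x) * Φ (g * γ s) x =
          Complex.exp (-(s * (μ H - rho α H))) * Complex.exp (-(s * c)) *
            ∫ x, starRingEnd ℂ (θ x) * Φ g x

/-- Smooth sections of the bundle `E_l` (twisted by `L_{μ-ρ}`). -/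
def IsSectionE (T : Subgroup G) {n : ℕ} (α : Fin n → Functional (d := d) T)
    (E F : Fin n → LieAlg d G) (μ : Functional (d := d) T) (l : ℕ) (Φ : G → Fun n) : Prop :=
  IsSection T α E F μ Φ ∧ ∀ g, Φ g ∈ Efib n l

/-! ### The operators -/

/-- The symplectic Dirac operator `D = ∑_j (σ(E_j) F_j - σ(F_j) E_j)`. -/
def dirac {n : ℕ} (E F : Fin n → LieAlg d G) (Φ : G → Fun n) : G → Fun n :=
  ∑ j, (sig E F (toC (E j)) (lieD (toC (F j)) Φ) - sig E F (toC (F j)) (lieD (toC (E j)) Φ))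

/-- The symplectic Dirac operator `D~ = ∑_j (σ(E_j) E_j + σ(F_j) F_j)`. -/
def diracTilde {n : ℕ} (E F : Fin n → LieAlg d G) (Φ : G → Fun n) : G → Fun n :=
  ∑ j, (sig E F (toC (E j)) (lieD (toC (E j)) Φ) + sig E F (toC (F j)) (lieD (toC (F j)) Φ))

/-- The symplectic Dolbeault operator `𝒟 = D + i D~`. -/
def dolbeault {n : ℕ} (E F : Fin n → LieAlg d G) (Φ : G → Fun n) : G → Fun n :=
  dirac E F Φ + Complex.I • diracTilde E F Φ

/-- The symplectic Dolbeault operator `𝒟̄ = D - i D~`. -/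
def dolbeaultBar {n : ℕ} (E F : Fin n → LieAlg d G) (Φ : G → Fun n) : G → Fun n :=
  dirac E F Φ - Complex.I • diracTilde E F Φ

/-- `P = ½ [𝒟, 𝒟̄]`; the operator `P_μ` is `P` on the sections twisted by `L_{μ-ρ}`. -/
def P {n : ℕ} (E F : Fin n → LieAlg d G) (Φ : G → Fun n) : G → Fun n :=
  (1 / 2 : ℂ) • (dolbeault E F (dolbeaultBar E F Φ) - dolbeaultBar E F (dolbeault E F Φ))

/-- `∑_i X_i²` as a differential operator, for a finite family `X` in `𝔤`.  For an orthonormal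
basis of `𝔤` (of `𝔱`) this is the Casimir operator `Ω_𝔤` (`Ω_𝔱`). -/
def casimir {ι : Type*} [Fintype ι] {n : ℕ} (X : ι → LieAlg d G) (Φ : G → Fun n) : G → Fun n :=
  ∑ i, lieD (toC (X i)) (lieD (toC (X i)) Φ)

end Group

end

end FlagDirac

/-! The computation takes place in an operator algebra on jointly smooth functions of `(g, x)`.
Left-invariant derivatives act in `g` and the operators `σ(v)` act in `x`, so the two kinds commute.
The derivatives represent the complexified Lie algebra, and the `σ(v)` satisfy `[σ(Z̄_a), σ(Z_b)] =
-½ δ_ab`.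

The Dolbeault operators factor as `𝒟 = 4i ∑ σ(Z̄_a) Z_a` and `𝒟̄ = -4i ∑ σ(Z_b) Z̄_b`. In `½ [𝒟,
𝒟̄]` the terms with `a ≠ b` have commuting `σ` factors and leave only Lie brackets. The diagonal
terms also produce `-(E_j² + F_j²)`, because `σ(Z_j)` and `σ(Z̄_j)` do not commute
(`half_commutator`). Summed over `j` this is `-Ω_𝔤 + Ω_𝔱`, as a Casimir sum is independent of the
orthonormal basis (`sum_mul_self_eq`). Invariance of the Killing form gives `[Z_α, Z̄_α] = ½ H_α`
(`lie_root_neg_root`).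

The fibre `E_0^0` is the line of the Gaussian, the vacuum annihilated by every `σ(Z̄_a)`. There
`m_*(ad H)` is the zero-point energy `ρ(H)`, which cancels the twist by `-ρ`; hence `H ∈ 𝔱` acts on
sections of `E_0` by `-μ(H)` (`lieReal_eq_neg_smul`). So `Ω_𝔱` becomes `‖μ‖²`, the `H_α` term
becomes `2 g₀(ρ, μ)`, and the last sum vanishes. -/

namespace FlagDirac
noncomputable section

/-! ### Brackets of vector fields as commutators of derivations -/

section Manifold
open VectorField Set
variable {E : Type*} [NormedAddCommGroup E] [NormedSpace ℝ E]
  {H : Type*} [TopologicalSpace H] {I : ModelWithCorners ℝ E H}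
  {M : Type*} [TopologicalSpace M] [ChartedSpace H M]
  {F : Type*} [NormedAddCommGroup F] [NormedSpace ℝ F]

/-- The derivative of a vector-valued function along a vector field. -/
def derivAlong (V : Π y : M, TangentSpace I y) (f : M → F) (y : M) : F :=
  mfderiv I 𝓘(ℝ, F) f y (V y)

/-- The derivative of a function, computed in the chart at the base point. -/
theorem mfderiv_apply_eq_fderiv [IsManifold I 1 M] [I.Boundaryless] {f : M → F} {x : M}
    (hf : MDifferentiableAt I 𝓘(ℝ, F) f x) (X : TangentSpace I x) :
    (mfderiv I 𝓘(ℝ, F) f x X : F) =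
      fderiv ℝ (f ∘ (extChartAt I x).symm) (extChartAt I x x)
        (mfderiv I 𝓘(ℝ, E) (extChartAt I x) x X : E) := by
  set e := extChartAt I x with he
  have hex : e.symm (e x) = x := extChartAt_to_inv x
  have hd : MDifferentiableAt 𝓘(ℝ, E) I e.symm (e x) := by
    have := mdifferentiableWithinAt_extChartAt_symm (I := I) (mem_extChartAt_target (I := I) x)
    rwa [I.range_eq_univ, mdifferentiableWithinAt_univ] at this
  have hF : MDifferentiableAt 𝓘(ℝ, E) 𝓘(ℝ, F) (f ∘ e.symm) (e x) := by
    refine MDifferentiableAt.comp _ ?_ hd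
    rwa [hex]
  have heq : (f ∘ e.symm) ∘ e =ᶠ[nhds x] f := by
    filter_upwards [extChartAt_source_mem_nhds (I := I) x] with y hy
    simp only [Function.comp_apply]
    rw [(extChartAt I x).left_inv hy]
  have hcomp : mfderiv I 𝓘(ℝ, F) f x =
      (mfderiv 𝓘(ℝ, E) 𝓘(ℝ, F) (f ∘ e.symm) (e x)).comp (mfderiv I 𝓘(ℝ, E) e x) := by
    rw [← mfderiv_comp x hF (mdifferentiableAt_extChartAt (mem_chart_source H x))]
    exact (Filter.EventuallyEq.mfderiv_eq (I := I) (I' := 𝓘(ℝ, F)) heq).symm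
  rw [hcomp, mfderiv_eq_fderiv]
  rfl

variable [I.Boundaryless] [IsManifold I 2 M]

/-- In the chart at `x`, the derivative of `f` along a vector field `V` is the derivative of the
representative of `f` along the pulled back vector field. -/
theorem derivAlong_extChartAt_symm {f : M → F} (hf : MDifferentiable I 𝓘(ℝ, F) f)
    (V : Π y : M, TangentSpace I y) (x : M) {y : E} (hy : y ∈ (extChartAt I x).target) :
    derivAlong V f ((extChartAt I x).symm y) =
      fderiv ℝ (f ∘ (extChartAt I x).symm) y
        (mpullbackWithin 𝓘(ℝ, E) I (extChartAt I x).symm V univ y) := by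
  have hinv := isInvertible_mfderivWithin_extChartAt_symm (I := I) hy
  have hd : MDifferentiableAt 𝓘(ℝ, E) I (extChartAt I x).symm y := by
    have := mdifferentiableWithinAt_extChartAt_symm (I := I) hy
    rwa [I.range_eq_univ, mdifferentiableWithinAt_univ] at this
  rw [← mfderiv_eq_fderiv, mfderiv_comp y (hf _) hd, mpullbackWithin_apply]
  rw [I.range_eq_univ, mfderivWithin_univ] at hinv
  rw [mfderivWithin_univ]
  change _ = mfderiv I 𝓘(ℝ, F) f _ ((mfderiv 𝓘(ℝ, E) I (extChartAt I x).symm y) _)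
  rw [hinv.self_apply_inverse]
  rfl

/-- The manifold bracket is the flat bracket of the fields pulled back to the chart at `x`. For flat
fields the identity is the symmetry of the second derivative of `f`. -/
theorem derivAlong_mlieBracket [CompleteSpace E] {f : M → F} (hf : ContMDiff I 𝓘(ℝ, F) 2 f)
    {V W : Π y : M, TangentSpace I y} {x : M}
    (hV : MDifferentiableAt I I.tangent (fun y ↦ (V y : TangentBundle I M)) x)
    (hW : MDifferentiableAt I I.tangent (fun y ↦ (W y : TangentBundle I M)) x)
    (hVf : MDifferentiable I 𝓘(ℝ, F) (derivAlong V f))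
    (hWf : MDifferentiable I 𝓘(ℝ, F) (derivAlong W f)) :
    derivAlong (mlieBracket I V W) f x =
      derivAlong V (derivAlong W f) x - derivAlong W (derivAlong V f) x := by
  have hfd : MDifferentiable I 𝓘(ℝ, F) f := hf.mdifferentiable (by norm_num)
  set e := extChartAt I x with he
  have hx : e x ∈ e.target := mem_extChartAt_target x
  have hnhds : e.target ∈ nhds (e x) := extChartAt_target_mem_nhds x
  have hex : e.symm (e x) = x := extChartAt_to_inv x
  let V' : E → E := mpullbackWithin 𝓘(ℝ, E) I e.symm V univ
  let W' : E → E := mpullbackWithin 𝓘(ℝ, E) I e.symm W univ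
  have hV' : DifferentiableAt ℝ V' (e x) := by
    have := hV.mdifferentiableWithinAt (s := univ)
      |>.differentiableWithinAt_mpullbackWithin_vectorField
    rw [I.range_eq_univ, preimage_univ, inter_univ] at this
    exact differentiableWithinAt_univ.1 this
  have hW' : DifferentiableAt ℝ W' (e x) := by
    have := hW.mdifferentiableWithinAt (s := univ)
      |>.differentiableWithinAt_mpullbackWithin_vectorField
    rw [I.range_eq_univ, preimage_univ, inter_univ] at this
    exact differentiableWithinAt_univ.1 this
  have hF : ContDiffAt ℝ 2 (f ∘ e.symm) (e x) := by
    have h1 : ContMDiffAt 𝓘(ℝ, E) I 2 e.symm (e x) :=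
      (contMDiffOn_extChartAt_symm x).contMDiffAt hnhds
    exact (hf.contMDiffAt.comp _ h1).contDiffAt
  have key := fderiv_apply_lieBracket hF (by simp) hW' hV'
  -- The outer derivative sees the inner one on a neighbourhood, so the comparison with the chart
  -- must hold near `e x` and not only at it.
  have hcongr : ∀ U : Π y : M, TangentSpace I y,
      derivAlong U f ∘ e.symm =ᶠ[nhds (e x)]
      fun y ↦ fderiv ℝ (f ∘ e.symm) y (mpullbackWithin 𝓘(ℝ, E) I e.symm U univ y) := by
    intro U
    filter_upwards [hnhds] with y hy
    exact derivAlong_extChartAt_symm hfd U x hy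
  rw [← (hcongr V).fderiv_eq, ← (hcongr W).fderiv_eq,
    ← derivAlong_extChartAt_symm hWf V x hx, ← derivAlong_extChartAt_symm hVf W x hx, hex] at key
  rw [← key]
  have hb : mlieBracket I V W x = (mfderiv I 𝓘(ℝ, E) e x).inverse
      (lieBracket ℝ V' W' (e x) : E) := by
    refine (congrFun mlieBracketWithin_univ.symm x).trans (mlieBracketWithin_apply.trans ?_)
    rw [I.range_eq_univ, preimage_univ, univ_inter, ← lieBracketWithin_univ]
  have : IsManifold I 1 M := IsManifold.of_le (n := 2) (by norm_num)
  have hinv := isInvertible_mfderiv_extChartAt (I := I) (mem_extChartAt_source (I := I) x)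
  rw [derivAlong, hb, mfderiv_apply_eq_fderiv (hfd x)]
  exact congrArg (fderiv ℝ (f ∘ e.symm) (e x)) (hinv.self_apply_inverse _)
end Manifold

/-! ### Derivatives depending on parameters, and mixed partial derivatives -/

section Derivatives

variable {E : Type*} [NormedAddCommGroup E] [NormedSpace ℝ E]
  {F : Type*} [NormedAddCommGroup F] [NormedSpace ℝ F]
  {E₁ : Type*} [NormedAddCommGroup E₁] [NormedSpace ℝ E₁]
  {H : Type*} [TopologicalSpace H] {J : ModelWithCorners ℝ E₁ H}
  {N : Type*} [TopologicalSpace N] [ChartedSpace H N] [IsManifold J ∞ N]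

/-- Smoothness is asked only near the points `(p, u p)`, since the inverse chart to which this is
applied is smooth only on its target. -/
theorem contMDiff_fderiv_apply {f : N → E → F} {u : N → E}
    (hf : ∀ p, ContMDiffAt (J.prod 𝓘(ℝ, E)) 𝓘(ℝ, F) ∞ (fun q : N × E => f q.1 q.2) (p, u p))
    (hu : ContMDiff J 𝓘(ℝ, E) ∞ u) (v : E) :
    ContMDiff J 𝓘(ℝ, F) ∞ (fun p => fderiv ℝ (f p) (u p) v) := by
  intro p
  have key := ContMDiffAt.mfderiv_apply (m := ∞) (x₀ := p) (I := 𝓘(ℝ, E)) (I' := 𝓘(ℝ, F))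
    f u id (fun _ => v) (hf p) (hu p) contMDiffAt_id contMDiffAt_const (by simp)
  refine key.congr_of_eventuallyEq (Filter.Eventually.of_forall fun q => ?_)
  have := inTangentCoordinates_model_space (𝕜 := ℝ) (I := 𝓘(ℝ, E)) (I' := 𝓘(ℝ, F)) u
    (fun x => f x (u x)) (fun x => mfderiv 𝓘(ℝ, E) 𝓘(ℝ, F) (f x) (u x)) p
  refine Eq.trans ?_ (congrArg (fun L : E →L[ℝ] F => L v) (congrFun this q)).symm
  simp only [mfderiv_eq_fderiv]

/-- Both sides are values of the second derivative of the joint function, on the vectors `(w, 0)`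
and `(0, v)` in either order. -/
theorem fderiv_fderiv_comm {K : E → E₁ → F} {a : E} {x : E₁}
    (hK : ContDiffAt ℝ ∞ (fun p : E × E₁ => K p.1 p.2) (a, x)) (w : E) (v : E₁) :
    fderiv ℝ (fun b => fderiv ℝ (K b) x v) a w =
      fderiv ℝ (fun y => fderiv ℝ (fun b => K b y) a w) x v := by
  set L : E × E₁ → F := fun p => K p.1 p.2 with hL
  have hnear : ∀ᶠ p in nhds (a, x), DifferentiableAt ℝ L p := by
    have := (hK.of_le (m := 1) ENat.LEInfty.out).eventually (by decide)
    filter_upwards [this] with p hp using hp.differentiableAt (by simp)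
  have hD : DifferentiableAt ℝ (fderiv ℝ L) (a, x) :=
    (hK.fderiv_right (m := 1)
      (by rw [one_add_one_eq_two]; exact ENat.LEInfty.out)).differentiableAt (by simp)
  have h1 : (fun b => fderiv ℝ (K b) x v) =ᶠ[nhds a] fun b => fderiv ℝ L (b, x) (0, v) := by
    have hc : Filter.Tendsto (fun b : E => (b, x)) (nhds a) (nhds (a, x)) :=
      (by fun_prop : Continuous fun b : E => (b, x)).tendsto a
    filter_upwards [hc.eventually hnear] with b hb
    have := HasFDerivAt.comp (g := L) x hb.hasFDerivAt (hasFDerivAt_prodMk_right b x)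
    rw [show K b = L ∘ (fun y => (b, y)) from rfl, this.fderiv]
    simp
  have h2 : (fun y => fderiv ℝ (fun b => K b y) a w) =ᶠ[nhds x]
      fun y => fderiv ℝ L (a, y) (w, 0) := by
    have hc : Filter.Tendsto (fun y : E₁ => (a, y)) (nhds x) (nhds (a, x)) :=
      (by fun_prop : Continuous fun y : E₁ => (a, y)).tendsto x
    filter_upwards [hc.eventually hnear] with y hy
    have := HasFDerivAt.comp (g := L) (f := fun b => (b, y)) a hy.hasFDerivAt
      (hasFDerivAt_prodMk_left a y)
    rw [show (fun b => K b y) = L ∘ (fun b => (b, y)) from rfl, this.fderiv]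
    simp
  rw [h1.fderiv_eq, h2.fderiv_eq]
  have h3 := (HasFDerivAt.comp (g := fderiv ℝ L) a hD.hasFDerivAt
    (hasFDerivAt_prodMk_left a x)).clm_apply
    (hasFDerivAt_const ((0 : E), v) a)
  have h4 := (HasFDerivAt.comp (g := fderiv ℝ L) x hD.hasFDerivAt
    (hasFDerivAt_prodMk_right a x)).clm_apply
    (hasFDerivAt_const (w, (0 : E₁)) x)
  have h3' := congrArg (fun T => T w) h3.fderiv
  have h4' := congrArg (fun T => T v) h4.fderiv
  simp only [Function.comp_def] at h3' h4'
  rw [h3', h4']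
  have hsymm : IsSymmSndFDerivAt ℝ L (a, x) := hK.isSymmSndFDerivAt
    (by rw [minSmoothness_of_isRCLikeNormedField]; exact ENat.LEInfty.out)
  simpa using hsymm (w, 0) (0, v)

end Derivatives

/-! ### Left-invariant derivatives of functions on `G × ℝⁿ` -/

section Group

variable {d : ℕ} {G : Type*} [TopologicalSpace G] [ChartedSpace (EuclideanSpace ℝ (Fin d)) G]
  [Group G] [LieGroup (𝓡 d) ∞ G] {n : ℕ}

/-- Jointly smooth functions of `g ∈ G` and `x ∈ ℝⁿ`. -/
def IsSmooth (Φ : G → Fun n) : Prop :=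
  ContMDiff ((𝓡 d).prod (𝓡 n)) 𝓘(ℝ, ℂ) ∞ (fun p : G × EuclideanSpace ℝ (Fin n) => Φ p.1 p.2)

omit [Group G] [LieGroup (𝓡 d) ∞ G] in
theorem IsSmooth.left {Φ : G → Fun n} (h : IsSmooth (d := d) Φ) (x : EuclideanSpace ℝ (Fin n)) :
    ContMDiff (𝓡 d) 𝓘(ℝ, ℂ) ∞ (fun g => Φ g x) :=
  h.comp (contMDiff_id.prodMk contMDiff_const)

omit [Group G] [LieGroup (𝓡 d) ∞ G] in
theorem IsSmooth.right {Φ : G → Fun n} (h : IsSmooth (d := d) Φ) (g : G) :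
    ContDiff ℝ ∞ (Φ g) := by
  have : ContMDiff (𝓡 n) 𝓘(ℝ, ℂ) ∞ (Φ g) := h.comp (contMDiff_const.prodMk contMDiff_id)
  exact this.contDiff

theorem derivAt_eq_mfderiv {Φ : G → Fun n} (h : IsSmooth (d := d) Φ) (g : G)
    (x : EuclideanSpace ℝ (Fin n)) (X : LieAlg d G) :
    derivAt Φ g x X = (mfderiv (𝓡 d) 𝓘(ℝ, ℂ) (fun u => Φ (g * u) x) 1 X : ℂ) := by
  have h1 : MDifferentiableAt (𝓡 d) 𝓘(ℝ, ℂ) (fun g' => Φ g' x) (g * 1) :=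
    (h.left x).mdifferentiable (by simp) _
  have h2 : MDifferentiableAt (𝓡 d) (𝓡 d) (fun u : G => g * u) 1 :=
    (contMDiff_mul_left (I := 𝓡 d) (n := ∞) (a := g)).mdifferentiable (by simp) _
  have := mfderiv_comp (1 : G) h1 h2
  change _ = (mfderiv (𝓡 d) 𝓘(ℝ, ℂ) ((fun g' => Φ g' x) ∘ (fun u => g * u)) 1) X
  rw [this]
  -- With `L` and `w` typed over the model space, `g * 1` can be rewritten to `g` although the
  -- tangent spaces depend on the point.
  let L : G → EuclideanSpace ℝ (Fin d) →L[ℝ] ℂ :=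
    fun g' => mfderiv (𝓡 d) 𝓘(ℝ, ℂ) (fun g' => Φ g' x) g'
  let w : EuclideanSpace ℝ (Fin d) := mfderiv (𝓡 d) (𝓡 d) (fun u => g * u) 1 X
  change L g w = L (g * 1) w
  rw [mul_one]

theorem contDiffAt_chart {Φ : G → Fun n} (h : IsSmooth (d := d) Φ) (g : G)
    (x : EuclideanSpace ℝ (Fin n)) :
    ContMDiffAt (((𝓡 d).prod (𝓡 n)).prod (𝓡 d)) 𝓘(ℝ, ℂ) ∞
      (fun q : (G × EuclideanSpace ℝ (Fin n)) × EuclideanSpace ℝ (Fin d) =>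
        Φ (q.1.1 * (extChartAt (𝓡 d) (1 : G)).symm q.2) q.1.2)
      ((g, x), extChartAt (𝓡 d) (1 : G) 1) := by
  have h1 : ContMDiffAt (𝓡 d) (𝓡 d) ∞ (extChartAt (𝓡 d) (1 : G)).symm
      (extChartAt (𝓡 d) (1 : G) 1) :=
    (contMDiffOn_extChartAt_symm (1 : G)).contMDiffAt (extChartAt_target_mem_nhds 1)
  refine h.contMDiffAt.comp _ (ContMDiffAt.prodMk ?_ ?_)
  · exact (contMDiffAt_fst.comp _ contMDiffAt_fst).mul (ContMDiffAt.comp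
      (g := (extChartAt (𝓡 d) (1 : G)).symm) _ h1 contMDiffAt_snd)
  · exact contMDiffAt_snd.comp _ contMDiffAt_fst

/-- Left translation moves the derivative to `1`, and the chart at `1` makes it a flat derivative at
a fixed point along a fixed vector. Here `g` is only a parameter, so the results on parameters and
mixed partials apply. -/
theorem derivAt_eq_fderiv {Φ : G → Fun n} (h : IsSmooth (d := d) Φ) (g : G)
    (x : EuclideanSpace ℝ (Fin n)) (X : LieAlg d G) :
    derivAt Φ g x X =
      fderiv ℝ (fun a => Φ (g * (extChartAt (𝓡 d) (1 : G)).symm a) x)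
        (extChartAt (𝓡 d) (1 : G) 1)
        (mfderiv (𝓡 d) 𝓘(ℝ, EuclideanSpace ℝ (Fin d)) (extChartAt (𝓡 d) (1 : G)) 1 X :
          EuclideanSpace ℝ (Fin d)) := by
  have : IsManifold (𝓡 d) 1 G := IsManifold.of_le (n := ∞) (by simp)
  have hs : ContMDiff (𝓡 d) 𝓘(ℝ, ℂ) ∞ (fun u => Φ (g * u) x) :=
    (h.left x).comp contMDiff_mul_left
  rw [derivAt_eq_mfderiv h, mfderiv_apply_eq_fderiv (hs.mdifferentiable (by simp) 1)]
  rfl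

theorem IsSmooth.derivAt {Φ : G → Fun n} (h : IsSmooth (d := d) Φ) (X : LieAlg d G) :
    IsSmooth (d := d) (fun g x => derivAt Φ g x X) := by
  simp only [IsSmooth, derivAt_eq_fderiv h]
  exact contMDiff_fderiv_apply (fun p => contDiffAt_chart h p.1 p.2) contMDiff_const _

/-- The partial derivative in `x` in the direction `v`. -/
def partialX (v : EuclideanSpace ℝ (Fin n)) (Φ : G → Fun n) : G → Fun n :=
  fun g x => fderiv ℝ (Φ g) x v

theorem IsSmooth.partialX {Φ : G → Fun n} (h : IsSmooth (d := d) Φ)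
    (v : EuclideanSpace ℝ (Fin n)) : IsSmooth (d := d) (partialX v Φ) := by
  refine contMDiff_fderiv_apply (N := G × EuclideanSpace ℝ (Fin n)) (f := fun p => Φ p.1)
    (fun p => ContMDiff.contMDiffAt ?_) contMDiff_snd v
  exact h.comp ((contMDiff_fst.comp contMDiff_fst).prodMk contMDiff_snd)

theorem derivAt_partialX {Φ : G → Fun n} (h : IsSmooth (d := d) Φ)
    (v : EuclideanSpace ℝ (Fin n)) (X : LieAlg d G) (g : G) (x : EuclideanSpace ℝ (Fin n)) :
    derivAt (partialX v Φ) g x X = partialX v (fun g x => derivAt Φ g x X) g x := by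
  rw [derivAt_eq_fderiv (h.partialX v)]
  simp only [FlagDirac.partialX, derivAt_eq_fderiv h]
  refine fderiv_fderiv_comm (K := fun a y => Φ (g * (extChartAt (𝓡 d) (1 : G)).symm a) y) ?_ _ _
  have h2 := (contDiffAt_chart h g x).comp (extChartAt (𝓡 d) (1 : G) 1, x)
    (f := fun q : EuclideanSpace ℝ (Fin d) × EuclideanSpace ℝ (Fin n) => ((g, q.2), q.1))
    ((contMDiffAt_const.prodMk contDiff_snd.contMDiff.contMDiffAt).prodMk
      contDiff_fst.contMDiff.contMDiffAt)
  exact h2.contDiffAt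

theorem derivAt_lie {Φ : G → Fun n} (h : IsSmooth (d := d) Φ) (X Y : LieAlg d G) (g : G)
    (x : EuclideanSpace ℝ (Fin n)) :
    derivAt Φ g x ⁅X, Y⁆ =
      derivAt (fun g x => derivAt Φ g x Y) g x X - derivAt (fun g x => derivAt Φ g x X) g x Y := by
  have : IsManifold (𝓡 d) 2 G := IsManifold.of_le (n := ∞) ENat.LEInfty.out
  have key := derivAlong_mlieBracket (I := 𝓡 d) (f := fun g => Φ g x)
    (V := mulInvariantVectorField X) (W := mulInvariantVectorField Y) (x := g)
    ((h.left x).of_le ENat.LEInfty.out)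
    (mdifferentiableAt_mulInvariantVectorField X) (mdifferentiableAt_mulInvariantVectorField Y)
    (((h.derivAt X).left x).mdifferentiable (by simp))
    (((h.derivAt Y).left x).mdifferentiable (by simp))
  rw [← mulInvariantVector_mlieBracket] at key
  exact key

end Group

/-! ### Passage to the complexified Lie algebra -/

section Lie

/-- A representation of a real Lie algebra in a complex associative algebra extends to the
complexification. -/
theorem liftBaseChange_lie {L A : Type*} [LieRing L] [LieAlgebra ℝ L] [Ring A] [Algebra ℂ A]
    (f : L →ₗ[ℝ] A) (hf : ∀ X Y, f ⁅X, Y⁆ = f X * f Y - f Y * f X)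
    (X Y : ℂ ⊗[ℝ] L) :
    f.liftBaseChange ℂ ⁅X, Y⁆ = f.liftBaseChange ℂ X * f.liftBaseChange ℂ Y -
      f.liftBaseChange ℂ Y * f.liftBaseChange ℂ X := by
  induction X using TensorProduct.induction_on with
  | zero => simp
  | add X X' hX hX' => simp only [add_lie, map_add, hX, hX']; noncomm_ring
  | tmul c X =>
    induction Y using TensorProduct.induction_on with
    | zero =>
      rw [lie_zero (L := ℂ ⊗[ℝ] L) (M := ℂ ⊗[ℝ] L)]
      simp
    | add Y Y' hY hY' =>
      rw [lie_add (L := ℂ ⊗[ℝ] L) (M := ℂ ⊗[ℝ] L), map_add, hY, hY', map_add]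
      noncomm_ring
    | tmul c' Y =>
      rw [LieAlgebra.ExtendScalars.bracket_tmul]
      simp only [LinearMap.liftBaseChange_tmul, hf, smul_mul_smul_comm, smul_sub, mul_comm c' c]

end Lie

/-! ### The operator algebra on smooth fields -/

section Group

variable {d : ℕ} {G : Type*} [TopologicalSpace G] [ChartedSpace (EuclideanSpace ℝ (Fin d)) G]
  [Group G] [LieGroup (𝓡 d) ∞ G] {n : ℕ}

omit [Group G] [LieGroup (𝓡 d) ∞ G] in
theorem IsSmooth.const_smul {Φ : G → Fun n} (h : IsSmooth (d := d) Φ) (c : ℂ) :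
    IsSmooth (d := d) (c • Φ) :=
  (contDiff_const_smul c).contMDiff.comp h

variable (d G n) in
/-- The space of jointly smooth functions on `G × ℝⁿ`. -/
def smoothFields : Submodule ℂ (G → Fun n) where
  carrier := {Φ | IsSmooth (d := d) Φ}
  add_mem' h₁ h₂ := ContMDiff.add h₁ h₂
  zero_mem' := contMDiff_const
  smul_mem' c _ h := h.const_smul c

variable (d G n) in
/-- Jointly smooth functions on `G × ℝⁿ`, as a type. -/
def SmoothField : Type _ := smoothFields d G n

instance : AddCommGroup (SmoothField d G n) := inferInstanceAs (AddCommGroup (smoothFields d G n))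

instance : Module ℂ (SmoothField d G n) := inferInstanceAs (Module ℂ (smoothFields d G n))

namespace SmoothField

variable (d G n) in
/-- The underlying function of a smooth field. -/
def val : SmoothField d G n →ₗ[ℂ] (G → Fun n) := (smoothFields d G n).subtype

omit [Group G] [LieGroup (𝓡 d) ∞ G] in
theorem smooth (Φ : SmoothField d G n) : IsSmooth (d := d) (val d G n Φ) := Φ.2

omit [Group G] [LieGroup (𝓡 d) ∞ G] in
@[ext]
theorem ext {Φ Ψ : SmoothField d G n} (h : ∀ g x, val d G n Φ g x = val d G n Ψ g x) : Φ = Ψ :=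
  Subtype.ext (funext fun g => funext fun x => h g x)

end SmoothField

omit [LieGroup (𝓡 d) ∞ G] in
theorem derivAt_add {Φ Ψ : G → Fun n} (h₁ : IsSmooth (d := d) Φ) (h₂ : IsSmooth (d := d) Ψ)
    (g : G) (x : EuclideanSpace ℝ (Fin n)) (X : LieAlg d G) :
    derivAt (Φ + Ψ) g x X = derivAt Φ g x X + derivAt Ψ g x X := by
  have := mfderiv_add (((h₁.left x).mdifferentiable (by simp)) g)
    (((h₂.left x).mdifferentiable (by simp)) g)
  exact congrArg (fun L : EuclideanSpace ℝ (Fin d) →L[ℝ] ℂ => L (mulInvariantVectorField X g)) this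

omit [LieGroup (𝓡 d) ∞ G] in
theorem derivAt_const_smul {Φ : G → Fun n} (h : IsSmooth (d := d) Φ) (c : ℂ)
    (g : G) (x : EuclideanSpace ℝ (Fin n)) (X : LieAlg d G) :
    derivAt (c • Φ) g x X = c • derivAt Φ g x X := by
  have := ((ContinuousLinearMap.mul ℝ ℂ c).hasMFDerivAt.comp g
    (((h.left x).mdifferentiable (by simp)) g).hasMFDerivAt).mfderiv
  exact congrArg (fun L : EuclideanSpace ℝ (Fin d) →L[ℝ] ℂ => L (mulInvariantVectorField X g)) this

/-- Differentiation along real left-invariant vector fields. -/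
def lieReal : LieAlg d G →ₗ[ℝ] Module.End ℂ (SmoothField d G n) where
  toFun X :=
    { toFun := fun Φ => ⟨fun g x => derivAt (Φ.val d G n) g x X, Φ.smooth.derivAt X⟩
      map_add' := fun Φ Ψ => by
        ext g x
        exact derivAt_add Φ.smooth Ψ.smooth g x X
      map_smul' := fun c Φ => by
        ext g x
        exact derivAt_const_smul Φ.smooth c g x X }
  map_add' X Y := by
    ext Φ g x
    exact (derivAt (Φ.val d G n) g x).map_add X Y
  map_smul' c X := by
    ext Φ g x
    exact (derivAt (Φ.val d G n) g x).map_smul c X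

/-- Differentiation along complex left-invariant vector fields. -/
def lieOp : LieAlgC d G →ₗ[ℂ] Module.End ℂ (SmoothField d G n) :=
  lieReal.liftBaseChange ℂ

theorem lieOp_toC (X : LieAlg d G) : lieOp (n := n) (toC X) = lieReal X := by
  simp [lieOp, toC]

theorem val_lieOp (X : LieAlgC d G) (Φ : SmoothField d G n) :
    (lieOp X Φ).val d G n = lieD X (Φ.val d G n) := by
  funext g x
  induction X using TensorProduct.induction_on with
  | zero => simp [lieD]
  | tmul c X =>
    simp only [lieOp, lieD, LinearMap.liftBaseChange_tmul]
    rfl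
  | add X Y hX hY =>
    simp only [lieD, map_add] at hX hY ⊢
    rw [← hX, ← hY]
    rfl

theorem lieReal_lie (X Y : LieAlg d G) :
    lieReal (n := n) ⁅X, Y⁆ = lieReal X * lieReal Y - lieReal Y * lieReal X := by
  ext Φ g x
  exact derivAt_lie Φ.smooth X Y g x

theorem lieOp_lie (X Y : LieAlgC d G) :
    lieOp (n := n) ⁅X, Y⁆ = lieOp X * lieOp Y - lieOp Y * lieOp X :=
  liftBaseChange_lie (L := LieAlg d G) lieReal lieReal_lie X Y

/-- Multiplication by the coordinate `x_j`. -/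
def coordOp (j : Fin n) : Module.End ℂ (SmoothField d G n) where
  toFun Φ := ⟨fun g x => (x j : ℂ) * (Φ.val d G n) g x, by
    have h1 : ContMDiff ((𝓡 d).prod (𝓡 n)) 𝓘(ℝ, ℂ) ∞
        (fun p : G × EuclideanSpace ℝ (Fin n) => ((p.2 j : ℝ) : ℂ)) := by
      have : ContDiff ℝ ∞ (fun x : EuclideanSpace ℝ (Fin n) => ((x j : ℝ) : ℂ)) :=
        Complex.ofRealCLM.contDiff.comp (EuclideanSpace.proj (𝕜 := ℝ) j).contDiff
      exact this.contMDiff.comp contMDiff_snd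
    exact contDiff_mul.contMDiff.comp (h1.prodMk_space Φ.smooth)⟩
  map_add' Φ Ψ := by
    ext g x
    exact mul_add _ _ _
  map_smul' c Φ := by
    ext g x
    exact mul_left_comm _ _ _

/-- The partial derivative with respect to `x_j`. -/
def partialOp (j : Fin n) : Module.End ℂ (SmoothField d G n) where
  toFun Φ := ⟨partialX (EuclideanSpace.single j 1) (Φ.val d G n), Φ.smooth.partialX _⟩
  map_add' Φ Ψ := by
    ext g x
    have := fderiv_add ((Φ.smooth.right g).differentiable (by simp) x)
      ((Ψ.smooth.right g).differentiable (by simp) x)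
    exact congrArg (fun L => L (EuclideanSpace.single j 1)) this
  map_smul' c Φ := by
    ext g x
    have := fderiv_const_smul ((Φ.smooth.right g).differentiable (by simp) x) c
    exact congrArg (fun L => L (EuclideanSpace.single j 1)) this

omit [Group G] [LieGroup (𝓡 d) ∞ G] in
theorem coordOp_mul_comm (i j : Fin n) :
    coordOp (d := d) (G := G) i * coordOp j = coordOp j * coordOp i := by
  ext Φ g x
  exact mul_left_comm _ _ _

theorem partialOp_mul_comm (i j : Fin n) :
    partialOp (d := d) (G := G) i * partialOp j = partialOp j * partialOp i := by
  ext Φ g x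
  have hc := Φ.smooth.right g
  have hd : DifferentiableAt ℝ (fderiv ℝ ((Φ.val d G n) g)) x :=
    (hc.fderiv_right (m := 1) (by rw [one_add_one_eq_two]; exact ENat.LEInfty.out)).differentiable
      (by simp) x
  have hs : IsSymmSndFDerivAt ℝ ((Φ.val d G n) g) x := hc.contDiffAt.isSymmSndFDerivAt
    (by rw [minSmoothness_of_isRCLikeNormedField]; exact ENat.LEInfty.out)
  have key : ∀ v w : EuclideanSpace ℝ (Fin n),
      fderiv ℝ (fun y => fderiv ℝ ((Φ.val d G n) g) y v) x w =
        fderiv ℝ (fderiv ℝ ((Φ.val d G n) g)) x w v := by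
    intro v w
    rw [(hd.hasFDerivAt.clm_apply (hasFDerivAt_const v x)).fderiv]
    simp
  exact (key _ _).trans ((hs _ _).trans (key _ _).symm)

theorem partialOp_mul_coordOp (i j : Fin n) :
    partialOp (d := d) (G := G) i * coordOp j = coordOp j * partialOp i +
      if i = j then 1 else 0 := by
  ext Φ g x
  have hd : HasFDerivAt (fun y : EuclideanSpace ℝ (Fin n) => ((y j : ℝ) : ℂ))
      (Complex.ofRealCLM.comp (EuclideanSpace.proj (𝕜 := ℝ) j)) x :=
    (Complex.ofRealCLM.comp (EuclideanSpace.proj (𝕜 := ℝ) j)).hasFDerivAt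
  have := hd.mul ((Φ.smooth.right g).differentiable (by simp) x).hasFDerivAt
  have h2 := congrArg (fun L => L (EuclideanSpace.single i 1)) this.fderiv
  refine h2.trans ?_
  simp only [add_apply, smul_apply, smul_eq_mul]
  rw [LinearMap.add_apply, map_add]
  change _ = (x j : ℂ) * fderiv ℝ (Φ.val d G n g) x (EuclideanSpace.single i 1) + _
  congr 1
  by_cases hij : i = j
  · subst hij; simp
  · have : j ≠ i := fun h => hij h.symm
    simp [hij, this]

theorem lieOp_commute_coordOp (X : LieAlgC d G) (j : Fin n) :
    Commute (lieOp X) (coordOp (d := d) (G := G) j) := by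
  induction X using TensorProduct.induction_on with
  | zero => simp
  | add X Y hX hY => rw [map_add]; exact hX.add_left hY
  | tmul c X =>
    simp only [lieOp, LinearMap.liftBaseChange_tmul]
    refine Commute.smul_left ?_ c
    ext Φ g x
    -- Differentiation is in `g` with `x` fixed, so the coordinate is a constant scalar.
    exact derivAt_const_smul Φ.smooth (x j : ℂ) g x X

theorem lieOp_commute_partialOp (X : LieAlgC d G) (j : Fin n) :
    Commute (lieOp X) (partialOp (d := d) (G := G) j) := by
  induction X using TensorProduct.induction_on with
  | zero => simp
  | add X Y hX hY => rw [map_add]; exact hX.add_left hY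
  | tmul c X =>
    simp only [lieOp, LinearMap.liftBaseChange_tmul]
    refine Commute.smul_left ?_ c
    ext Φ g x
    exact derivAt_partialX Φ.smooth _ X g x

/-- Canonical quantization as an operator on smooth fields. -/
def sigOp (E F : Fin n → LieAlg d G) : LieAlgC d G →ₗ[ℂ] Module.End ℂ (SmoothField d G n) where
  toFun v := ∑ j, (g0C d G v (toC (E j)) • (Complex.I • coordOp j) +
    g0C d G v (toC (F j)) • partialOp j)
  map_add' v w := by
    rw [← Finset.sum_add_distrib]
    refine Finset.sum_congr rfl fun j _ => ?_
    rw [map_add, LinearMap.add_apply, LinearMap.add_apply, add_smul, add_smul, add_add_add_comm]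
  map_smul' c v := by
    rw [Finset.smul_sum]
    refine Finset.sum_congr rfl fun j _ => ?_
    rw [map_smul, LinearMap.smul_apply, LinearMap.smul_apply, smul_assoc, smul_assoc, smul_add,
      RingHom.id_apply]

theorem sigOp_apply (E F : Fin n → LieAlg d G) (v : LieAlgC d G) :
    sigOp E F v = ∑ j, (g0C d G v (toC (E j)) • (Complex.I • coordOp j) +
      g0C d G v (toC (F j)) • partialOp j) := rfl

theorem val_sigOp (E F : Fin n → LieAlg d G) (v : LieAlgC d G) (Φ : SmoothField d G n) :
    (sigOp E F v Φ).val d G n = sig E F v (Φ.val d G n) := by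
  simp only [sigOp_apply, LinearMap.sum_apply, LinearMap.add_apply,
    LinearMap.smul_apply, map_sum, map_add, map_smul]
  funext g x
  simp only [sig, sigma, Finset.sum_apply, Pi.add_apply, Pi.smul_apply, smul_eq_mul]
  refine Finset.sum_congr rfl fun j _ => ?_
  simp only [mul_assoc]
  rfl

theorem lieOp_commute_sigOp (E F : Fin n → LieAlg d G) (X v : LieAlgC d G) :
    Commute (lieOp X) (sigOp E F v) := by
  rw [sigOp_apply]
  refine Commute.sum_right _ _ _ fun j _ => Commute.add_right ?_ ?_
  · exact ((lieOp_commute_coordOp X j).smul_right _).smul_right _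
  · exact (lieOp_commute_partialOp X j).smul_right _

end Group

/-! ### Orthonormal families and the complexified form -/

section Orthonormal

variable {L : Type*} [AddCommGroup L] [Module ℝ L] {B : LinearMap.BilinForm ℝ L}
  {κ : Type*} [Fintype κ] [DecidableEq κ]

/-- Expansion of a vector in an orthonormal spanning family. -/
theorem sum_smul_of_orthonormal {Y : κ → L} (hY : ∀ i j, B (Y i) (Y j) = if i = j then 1 else 0)
    (hspan : ⊤ ≤ Submodule.span ℝ (Set.range Y)) (v : L) : ∑ i, B v (Y i) • Y i = v := by
  have hv : v ∈ Submodule.span ℝ (Set.range Y) := hspan trivial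
  induction hv using Submodule.span_induction with
  | mem x hx =>
    obtain ⟨j, rfl⟩ := hx
    simp [hY]
  | zero => simp
  | add x y _ _ hx hy => simp only [map_add, LinearMap.add_apply, add_smul,
      Finset.sum_add_distrib, hx, hy]
  | smul c x _ hx => simp only [map_smul, LinearMap.smul_apply, smul_assoc, ← Finset.smul_sum, hx]

/-- A sum of squares over an orthonormal spanning family does not depend on the family. -/
theorem sum_mul_self_eq {A : Type*} [Ring A] [Algebra ℝ A] (hB : ∀ x y, B x y = B y x)
    {ι : Type*} [Fintype ι] [DecidableEq ι] {X : ι → L} {Y : κ → L}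
    (hX : ∀ i j, B (X i) (X j) = if i = j then 1 else 0)
    (hXspan : ⊤ ≤ Submodule.span ℝ (Set.range X))
    (hY : ∀ i j, B (Y i) (Y j) = if i = j then 1 else 0)
    (hYspan : ⊤ ≤ Submodule.span ℝ (Set.range Y)) (f : L →ₗ[ℝ] A) :
    ∑ i, f (X i) * f (X i) = ∑ j, f (Y j) * f (Y j) := by
  -- Expanding the second factor on the left in `Y` and the first factor on the right in `X` turns
  -- both sides into the same double sum.
  have h1 : ∀ i, f (X i) * f (X i) = ∑ j, B (X i) (Y j) • (f (X i) * f (Y j)) := by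
    intro i
    have e := congrArg f (sum_smul_of_orthonormal hY hYspan (X i))
    simp only [map_sum, map_smul] at e
    conv_lhs => arg 2; rw [← e]
    simp only [Finset.mul_sum, mul_smul_comm]
  have h2 : ∀ j, f (Y j) * f (Y j) = ∑ i, B (X i) (Y j) • (f (X i) * f (Y j)) := by
    intro j
    have e := congrArg f (sum_smul_of_orthonormal hX hXspan (Y j))
    simp only [map_sum, map_smul, hB (Y j)] at e
    conv_lhs => arg 1; rw [← e]
    simp only [Finset.sum_mul, smul_mul_assoc]
  simp only [h1, h2]
  exact Finset.sum_comm

theorem baseChange_toC (x y : L) :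
    B.baseChange ℂ ((1 : ℂ) ⊗ₜ[ℝ] x) ((1 : ℂ) ⊗ₜ[ℝ] y) = (B x y : ℂ) := by
  rw [LinearMap.BilinForm.baseChange_tmul]
  simp [Algebra.smul_def]

theorem baseChange_symm (hB : ∀ x y, B x y = B y x) (v w : ℂ ⊗[ℝ] L) :
    B.baseChange ℂ v w = B.baseChange ℂ w v := by
  induction v using TensorProduct.induction_on with
  | zero => simp
  | add v v' hv hv' => simp only [map_add, LinearMap.add_apply, hv, hv']
  | tmul c v =>
    induction w using TensorProduct.induction_on with
    | zero => simp
    | add w w' hw hw' => simp only [map_add, LinearMap.add_apply, hw, hw']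
    | tmul c' w => simp only [LinearMap.BilinForm.baseChange_tmul, hB v w, mul_comm]

/-- The real orthonormal expansion extends complex linearly, so the pairings with the `Y i` are the
coordinates of `v`. -/
theorem baseChange_eq_zero {Y : κ → L} (hY : ∀ i j, B (Y i) (Y j) = if i = j then 1 else 0)
    (hspan : ⊤ ≤ Submodule.span ℝ (Set.range Y)) {v : ℂ ⊗[ℝ] L}
    (hv : ∀ i, B.baseChange ℂ v ((1 : ℂ) ⊗ₜ[ℝ] Y i) = 0) : v = 0 := by
  have key : ∑ i, B.baseChange ℂ v ((1 : ℂ) ⊗ₜ[ℝ] Y i) • ((1 : ℂ) ⊗ₜ[ℝ] Y i) = v := by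
    clear hv
    induction v using TensorProduct.induction_on with
    | zero => simp
    | add v v' hv hv' => simp only [map_add, LinearMap.add_apply, add_smul,
        Finset.sum_add_distrib, hv, hv']
    | tmul c v =>
      conv_rhs => rw [← sum_smul_of_orthonormal hY hspan v, TensorProduct.tmul_sum]
      refine Finset.sum_congr rfl fun i _ => ?_
      rw [LinearMap.BilinForm.baseChange_tmul, TensorProduct.smul_tmul', TensorProduct.tmul_smul,
        TensorProduct.smul_tmul']
      simp [Algebra.smul_def, mul_comm]
  rw [← key]
  simp [hv]

end Orthonormal

/-! ### The bracket of opposite root vectors -/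

section Root

variable {L : Type*} [LieRing L] [LieAlgebra ℝ L] {B : LinearMap.BilinForm ℝ L}

theorem baseChange_lie (hinv : ∀ x y z, B ⁅x, y⁆ z = B x ⁅y, z⁆) (u v w : ℂ ⊗[ℝ] L) :
    B.baseChange ℂ ⁅u, v⁆ w = B.baseChange ℂ u ⁅v, w⁆ := by
  induction u using TensorProduct.induction_on with
  | zero => rw [zero_lie (L := ℂ ⊗[ℝ] L) (M := ℂ ⊗[ℝ] L)]; simp
  | add u u' hu hu' =>
    rw [add_lie (L := ℂ ⊗[ℝ] L) (M := ℂ ⊗[ℝ] L)]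
    simp only [map_add, LinearMap.add_apply, hu, hu']
  | tmul a u =>
    induction v using TensorProduct.induction_on with
    | zero =>
      rw [lie_zero (L := ℂ ⊗[ℝ] L) (M := ℂ ⊗[ℝ] L), zero_lie (L := ℂ ⊗[ℝ] L) (M := ℂ ⊗[ℝ] L)]
      simp
    | add v v' hv hv' =>
      rw [lie_add (L := ℂ ⊗[ℝ] L) (M := ℂ ⊗[ℝ] L), add_lie (L := ℂ ⊗[ℝ] L) (M := ℂ ⊗[ℝ] L)]
      simp only [map_add, LinearMap.add_apply, hv, hv']
    | tmul b v =>
      induction w using TensorProduct.induction_on with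
      | zero => rw [lie_zero (L := ℂ ⊗[ℝ] L) (M := ℂ ⊗[ℝ] L)]; simp
      | add w w' hw hw' =>
        rw [lie_add (L := ℂ ⊗[ℝ] L) (M := ℂ ⊗[ℝ] L)]
        simp only [map_add, hw, hw']
      | tmul c w =>
        simp only [LieAlgebra.ExtendScalars.bracket_tmul, LinearMap.BilinForm.baseChange_tmul, hinv]
        congr 1
        ring

/-- The bracket of opposite root vectors with respect to an orthonormal basis adapted to the root
space decomposition. -/
theorem lie_root_neg_root {k n : ℕ} (hB : ∀ x y, B x y = B y x)
    (hinv : ∀ x y z, B ⁅x, y⁆ z = B x ⁅y, z⁆) {h : Fin k → L} {E F : Fin n → L}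
    (hON : ∀ i j, B (Sum.elim h (Sum.elim E F) i) (Sum.elim h (Sum.elim E F) j) =
      if i = j then 1 else 0)
    (hspan : ⊤ ≤ Submodule.span ℝ (Set.range (Sum.elim h (Sum.elim E F))))
    {Z Z' : Fin n → ℂ ⊗[ℝ] L}
    (hZ : ∀ j, Z j = (1 / 2 : ℂ) • ((1 : ℂ) ⊗ₜ[ℝ] E j - Complex.I • ((1 : ℂ) ⊗ₜ[ℝ] F j)))
    (hZ' : ∀ j, Z' j = (1 / 2 : ℂ) • ((1 : ℂ) ⊗ₜ[ℝ] E j + Complex.I • ((1 : ℂ) ⊗ₜ[ℝ] F j)))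
    {a : Fin n → Fin k → ℂ} (ha : ∀ j, ∃ i, a j i ≠ 0)
    (hr : ∀ i j, ⁅((1 : ℂ) ⊗ₜ[ℝ] h i), Z j⁆ = a j i • Z j)
    (hr' : ∀ i j, ⁅((1 : ℂ) ⊗ₜ[ℝ] h i), Z' j⁆ = -a j i • Z' j) (j : Fin n) :
    ⁅Z j, Z' j⁆ = (1 / 2 : ℂ) • ∑ i, a j i • ((1 : ℂ) ⊗ₜ[ℝ] h i) := by
  set β := B.baseChange ℂ with hβ
  have hh : ∀ i i', β ((1 : ℂ) ⊗ₜ h i) ((1 : ℂ) ⊗ₜ h i') = if i = i' then 1 else 0 := by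
    intro i i'
    have := hON (Sum.inl i) (Sum.inl i')
    simp only [Sum.elim_inl, Sum.inl.injEq] at this
    rw [baseChange_toC, this]
    split_ifs <;> simp
  have hhE : ∀ i j, β ((1 : ℂ) ⊗ₜ h i) ((1 : ℂ) ⊗ₜ E j) = 0 := by
    intro i j
    have := hON (Sum.inl i) (Sum.inr (Sum.inl j))
    simp only [Sum.elim_inl, Sum.elim_inr, reduceCtorEq, if_false] at this
    rw [baseChange_toC, this]
    simp
  have hhF : ∀ i j, β ((1 : ℂ) ⊗ₜ h i) ((1 : ℂ) ⊗ₜ F j) = 0 := by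
    intro i j
    have := hON (Sum.inl i) (Sum.inr (Sum.inr j))
    simp only [Sum.elim_inl, Sum.elim_inr, reduceCtorEq, if_false] at this
    rw [baseChange_toC, this]
    simp
  have hEE : ∀ j, β ((1 : ℂ) ⊗ₜ E j) ((1 : ℂ) ⊗ₜ E j) = 1 := by
    intro j
    have := hON (Sum.inr (Sum.inl j)) (Sum.inr (Sum.inl j))
    simp only [Sum.elim_inl, Sum.elim_inr, if_true] at this
    rw [baseChange_toC, this]
    simp
  have hFF : ∀ j, β ((1 : ℂ) ⊗ₜ F j) ((1 : ℂ) ⊗ₜ F j) = 1 := by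
    intro j
    have := hON (Sum.inr (Sum.inr j)) (Sum.inr (Sum.inr j))
    simp only [Sum.elim_inr, if_true] at this
    rw [baseChange_toC, this]
    simp
  have hEF : ∀ j, β ((1 : ℂ) ⊗ₜ E j) ((1 : ℂ) ⊗ₜ F j) = 0 := by
    intro j
    have := hON (Sum.inr (Sum.inl j)) (Sum.inr (Sum.inr j))
    simp only [Sum.elim_inl, Sum.elim_inr, Sum.inr.injEq, reduceCtorEq, if_false] at this
    rw [baseChange_toC, this]
    simp
  have hFE : ∀ j, β ((1 : ℂ) ⊗ₜ F j) ((1 : ℂ) ⊗ₜ E j) = 0 := fun j => by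
    rw [hβ, baseChange_symm hB]; exact hEF j
  have hZZ' : β (Z j) (Z' j) = 1 / 2 := by
    rw [hZ, hZ']
    simp only [map_smul, map_sub, map_add, LinearMap.smul_apply, LinearMap.sub_apply, hEE, hFF,
      hEF, hFE, smul_eq_mul]
    linear_combination (-1 / 4) * Complex.I_mul_I
  have hE : ∀ j, ((1 : ℂ) ⊗ₜ[ℝ] E j) = Z j + Z' j := by
    intro j
    rw [hZ, hZ']
    module
  have hF : ∀ j, ((1 : ℂ) ⊗ₜ[ℝ] F j) = Complex.I • (Z j - Z' j) := by
    intro j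
    have : Z j - Z' j = -Complex.I • ((1 : ℂ) ⊗ₜ[ℝ] F j) := by
      rw [hZ, hZ']
      module
    rw [this, smul_smul]
    simp
  -- By the Leibniz rule the bracket has weight `a j - a j = 0`.
  have hcomm : ∀ i, ⁅((1 : ℂ) ⊗ₜ[ℝ] h i), ⁅Z j, Z' j⁆⁆ = 0 := by
    intro i
    have := leibniz_lie (L₁ := ℂ ⊗[ℝ] L) (L₂ := ℂ ⊗[ℝ] L) (M := ℂ ⊗[ℝ] L)
      ((1 : ℂ) ⊗ₜ[ℝ] h i) (Z j) (Z' j)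
    rw [hr, hr', smul_lie (L := ℂ ⊗[ℝ] L) (M := ℂ ⊗[ℝ] L),
      lie_smul (L := ℂ ⊗[ℝ] L) (M := ℂ ⊗[ℝ] L)] at this
    rw [this]
    simp
  -- A vector of weight zero is orthogonal to one of nonzero weight: invariance gives `c i * β ⁅Z j,
  -- Z' j⁆ W = 0`. This excludes all `E` and `F` components.
  have horth : ∀ (W : ℂ ⊗[ℝ] L) (c : Fin k → ℂ), (∃ i, c i ≠ 0) →
      (∀ i, ⁅((1 : ℂ) ⊗ₜ[ℝ] h i), W⁆ = c i • W) → β ⁅Z j, Z' j⁆ W = 0 := by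
    rintro W c ⟨i, hi⟩ hW
    have h1 := baseChange_lie hinv ⁅Z j, Z' j⁆ ((1 : ℂ) ⊗ₜ[ℝ] h i) W
    have h2 : ⁅⁅Z j, Z' j⁆, ((1 : ℂ) ⊗ₜ[ℝ] h i)⁆ = 0 := by
      rw [← lie_skew (L := ℂ ⊗[ℝ] L), hcomm, neg_zero]
    rw [h2, hW] at h1
    simpa [hi] using h1.symm
  have hZ0 : ∀ l, β ⁅Z j, Z' j⁆ (Z l) = 0 := fun l => horth _ (a l) (ha l) fun i => hr i l
  have hZ'0 : ∀ l, β ⁅Z j, Z' j⁆ (Z' l) = 0 := fun l =>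
    horth _ (fun i => -a l i) (by obtain ⟨i, hi⟩ := ha l; exact ⟨i, neg_ne_zero.2 hi⟩)
      fun i => hr' i l
  rw [← sub_eq_zero]
  refine baseChange_eq_zero (B := B) hON hspan ?_
  rintro (i | l | l)
  · simp only [Sum.elim_inl, map_sub, map_smul, map_sum, LinearMap.sub_apply, LinearMap.smul_apply,
      LinearMap.sum_apply]
    -- Invariance moves `h i` into a bracket with `Z' j`, leaving `a j i` times `β (Z j) (Z' j) =
    -- 1/2`; this is the source of the factor `½`.
    have h1 : β ⁅Z j, Z' j⁆ ((1 : ℂ) ⊗ₜ[ℝ] h i) = a j i * (1 / 2) := by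
      rw [hβ, baseChange_lie hinv, ← lie_skew (L := ℂ ⊗[ℝ] L), hr', neg_smul,
        neg_neg, map_smul, ← hβ, hZZ', smul_eq_mul]
    rw [← hβ, h1]
    simp [hh, mul_comm]
  · simp only [Sum.elim_inl, Sum.elim_inr, map_sub, map_smul, map_sum, LinearMap.sub_apply,
      LinearMap.smul_apply, LinearMap.sum_apply]
    rw [← hβ]
    simp only [hhE]
    rw [hE, map_add, hZ0, hZ'0]
    simp
  · simp only [Sum.elim_inr, map_sub, map_smul, map_sum, LinearMap.sub_apply,
      LinearMap.smul_apply, LinearMap.sum_apply]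
    rw [← hβ]
    simp only [hhF]
    rw [hF, map_smul, map_sub, hZ0, hZ'0]
    simp

end Root

/-! ### The commutator in an abstract associative algebra -/

section Algebra

variable {A : Type*} [Ring A] [Algebra ℂ A] {n : ℕ}

/-- Passing to `Z` and `Z̄` leaves one product per root in place of four; this one yields `𝒟`, and
`dirac_sub_I_smul` yields `𝒟̄`. -/
theorem dirac_add_I_smul (se sf le lf : Fin n → A) :
    ∑ j, (se j * lf j - sf j * le j) + Complex.I • ∑ j, (se j * le j + sf j * lf j) =
      (4 * Complex.I) • ∑ j, ((1 / 2 : ℂ) • (se j + Complex.I • sf j)) *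
        ((1 / 2 : ℂ) • (le j - Complex.I • lf j)) := by
  simp only [Finset.smul_sum, ← Finset.sum_add_distrib]
  refine Finset.sum_congr rfl fun j _ => ?_
  simp only [mul_sub, add_mul, smul_mul_assoc, mul_smul_comm, smul_sub,
    smul_add, smul_smul]
  match_scalars <;> ring_nf <;> simp

theorem dirac_sub_I_smul (se sf le lf : Fin n → A) :
    ∑ j, (se j * lf j - sf j * le j) - Complex.I • ∑ j, (se j * le j + sf j * lf j) =
      (-4 * Complex.I) • ∑ j, ((1 / 2 : ℂ) • (se j - Complex.I • sf j)) *
        ((1 / 2 : ℂ) • (le j + Complex.I • lf j)) := by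
  simp only [Finset.smul_sum, ← Finset.sum_sub_distrib]
  refine Finset.sum_congr rfl fun j _ => ?_
  simp only [mul_add, sub_mul, smul_mul_assoc, mul_smul_comm, smul_sub,
    smul_add, smul_smul]
  match_scalars <;> ring_nf <;> simp

/-- Here `z`, `z'` stand for `σ(Z)`, `σ(Z̄)`, and `Z`, `Z'` for the derivatives. The constants give
`½ · 16 = 8`. Commuting each `z` past each derivative reduces everything to a sum over pairs `(a,
b)`, where `hz` applies. -/
theorem half_commutator {z z' Z Z' le lf : Fin n → A}
    (hz : ∀ a b, z' a * z b = z b * z' a - if a = b then (1 / 2 : ℂ) • (1 : A) else 0)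
    (h1 : ∀ a b, Commute (Z a) (z b)) (h2 : ∀ a b, Commute (Z' a) (z' b))
    (hZ : ∀ j, Z j = (1 / 2 : ℂ) • (le j - Complex.I • lf j))
    (hZ' : ∀ j, Z' j = (1 / 2 : ℂ) • (le j + Complex.I • lf j)) :
    (1 / 2 : ℂ) • (((4 * Complex.I) • ∑ a, z' a * Z a) * ((-4 * Complex.I) • ∑ b, z b * Z' b) -
      ((-4 * Complex.I) • ∑ b, z b * Z' b) * ((4 * Complex.I) • ∑ a, z' a * Z a)) =
    -∑ j, (le j * le j + lf j * lf j) +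
      (4 : ℂ) • ∑ i, (z i * z' i + z' i * z i) * (Z i * Z' i - Z' i * Z i) -
      (8 : ℂ) • ∑ i, ∑ j ∈ Finset.univ.erase i, z i * z' j * (Z' i * Z j - Z j * Z' i) := by
  have hI : 4 * Complex.I * (-4 * Complex.I) = 16 := by linear_combination -16 * Complex.I_mul_I
  have hI' : -4 * Complex.I * (4 * Complex.I) = 16 := by linear_combination -16 * Complex.I_mul_I
  rw [smul_mul_smul_comm, smul_mul_smul_comm, hI, hI', ← smul_sub, smul_smul]
  have key : (∑ a, z' a * Z a) * (∑ b, z b * Z' b) - (∑ b, z b * Z' b) * (∑ a, z' a * Z a) =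
      ∑ b, ∑ a, (z' a * z b * (Z a * Z' b) - z b * z' a * (Z' b * Z a)) := by
    rw [Finset.sum_mul_sum, Finset.sum_mul_sum, Finset.sum_comm, ← Finset.sum_sub_distrib]
    refine Finset.sum_congr rfl fun b _ => ?_
    rw [← Finset.sum_sub_distrib]
    refine Finset.sum_congr rfl fun a _ => ?_
    rw [mul_assoc (z' a) (Z a), ← mul_assoc (Z a), (h1 a b).eq, mul_assoc (z b) (Z' b),
      ← mul_assoc (Z' b), (h2 b a).eq]
    noncomm_ring
  rw [key, Finset.smul_sum, Finset.smul_sum, Finset.smul_sum, ← Finset.sum_neg_distrib,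
    ← Finset.sum_add_distrib, ← Finset.sum_sub_distrib]
  refine Finset.sum_congr rfl fun b _ => ?_
  rw [← Finset.add_sum_erase _ _ (Finset.mem_univ b), smul_add, sub_eq_add_neg (_ + _)]
  congr 1
  -- Diagonal terms: with `u = z b * z' b`, both sides equal `8 u [Z b, Z' b] - 4 Z b * Z' b`.
  · have hzb : z' b * z b = z b * z' b - (1 / 2 : ℂ) • (1 : A) := by simpa using hz b b
    have hsq : Z b * Z' b + Z' b * Z b = (1 / 2 : ℂ) • (le b * le b + lf b * lf b) := by
      rw [hZ, hZ']
      simp only [mul_add, add_mul, mul_sub, sub_mul, smul_mul_assoc,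
        mul_smul_comm, smul_sub, smul_add, smul_smul]
      match_scalars <;> ring_nf
      simp
      norm_num
    have h4 : le b * le b + lf b * lf b = (2 : ℂ) • (Z b * Z' b + Z' b * Z b) := by
      rw [hsq, smul_smul]; norm_num
    rw [hzb, h4]
    simp only [sub_mul, add_mul, mul_sub, smul_mul_assoc, one_mul]
    module
  · rw [Finset.smul_sum, Finset.smul_sum, ← Finset.sum_neg_distrib]
    refine Finset.sum_congr rfl fun a ha => ?_
    have hab : a ≠ b := Finset.ne_of_mem_erase ha
    have := hz a b
    rw [if_neg hab, sub_zero] at this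
    rw [this]
    simp only [mul_sub]
    module

end Algebra

/-! ### The formula for `P` on all smooth fields -/

section Group

variable {d : ℕ} {G : Type*} [TopologicalSpace G] [ChartedSpace (EuclideanSpace ℝ (Fin d)) G]
  [Group G] [LieGroup (𝓡 d) ∞ G] {n : ℕ}

theorem g0C_toC (x y : LieAlg d G) : g0C d G (toC x) (toC y) = (g0 d G x y : ℂ) :=
  baseChange_toC x y

theorem g0_symm (x y : LieAlg d G) : g0 d G x y = g0 d G y x := by
  simp only [g0, LinearMap.neg_apply]
  rw [LieModule.traceForm_comm]

theorem g0_lie (x y z : LieAlg d G) : g0 d G ⁅x, y⁆ z = g0 d G x ⁅y, z⁆ := by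
  simp only [g0, LinearMap.neg_apply]
  rw [LieModule.traceForm_apply_lie_apply]

variable {T : Subgroup G} {α : Fin n → Functional (d := d) T} {E F : Fin n → LieAlg d G}

theorem IsRootFrame.sigOp_E (h : IsRootFrame T α E F) (j : Fin n) :
    sigOp E F (toC (E j)) = Complex.I • coordOp j := by
  simp only [sigOp_apply, g0C_toC, h.EE, h.EF]
  simp

theorem IsRootFrame.sigOp_F (h : IsRootFrame T α E F) (j : Fin n) :
    sigOp E F (toC (F j)) = partialOp j := by
  simp only [sigOp_apply, g0C_toC, h.FF, g0_symm (F j), h.EF]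
  simp

omit [LieGroup (𝓡 d) ∞ G] in
theorem map_Zvec {A : Type*} [AddCommGroup A] [Module ℂ A] (f : LieAlgC d G →ₗ[ℂ] A) (j : Fin n) :
    f (Zvec E F j) = (1 / 2 : ℂ) • (f (toC (E j)) - Complex.I • f (toC (F j))) := by
  simp only [Zvec, map_smul, map_sub]

omit [LieGroup (𝓡 d) ∞ G] in
theorem map_Zbar {A : Type*} [AddCommGroup A] [Module ℂ A] (f : LieAlgC d G →ₗ[ℂ] A) (j : Fin n) :
    f (Zbar E F j) = (1 / 2 : ℂ) • (f (toC (E j)) + Complex.I • f (toC (F j))) := by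
  simp only [Zbar, map_smul, map_add]

/-- The canonical commutation relations for `σ(Z̄_a) = (i/2)(x_a + ∂_a)` and `σ(Z_b) = (i/2)(x_b -
∂_b)`. -/
theorem IsRootFrame.sigOp_Zbar_mul_sigOp_Zvec (h : IsRootFrame T α E F) (a b : Fin n) :
    sigOp E F (Zbar E F a) * sigOp E F (Zvec E F b) =
      sigOp E F (Zvec E F b) * sigOp E F (Zbar E F a) -
        if a = b then (1 / 2 : ℂ) • (1 : Module.End ℂ (SmoothField d G n)) else 0 := by
  simp only [map_Zvec, map_Zbar, h.sigOp_E, h.sigOp_F, mul_add, add_mul,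
    mul_sub, sub_mul, smul_mul_assoc, mul_smul_comm, coordOp_mul_comm b a, partialOp_mul_comm b a,
    partialOp_mul_coordOp, smul_smul]
  rcases eq_or_ne a b with rfl | hab
  · simp only [if_true, smul_add, smul_sub, smul_smul]
    match_scalars <;> ring_nf
    simp
    norm_num
  · simp only [if_neg hab, if_neg hab.symm, add_zero, sub_zero, smul_add, smul_sub, smul_smul]
    match_scalars <;> ring_nf

section Frame

variable {k : ℕ} {h : Module.Basis (Fin k) ℝ (lieOf (d := d) T)}

/-- The orthonormal family of `𝔤` formed by a basis of `𝔱` and a root frame. -/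
def frame (h : Module.Basis (Fin k) ℝ (lieOf (d := d) T)) (E F : Fin n → LieAlg d G) :
    Fin k ⊕ Fin n ⊕ Fin n → LieAlg d G :=
  Sum.elim (fun i => (h i : LieAlg d G)) (Sum.elim E F)

theorem IsRootFrame.mem_perp (hEF : IsRootFrame T α E F) {x : LieAlg d G}
    (hx : x ∈ Set.range E ∪ Set.range F) (y : lieOf (d := d) T) : g0 d G y x = 0 := by
  have h1 : x ∈ lieOfPerp (d := d) T := hEF.span_eq ▸ Submodule.subset_span hx
  exact h1 _ y.2

theorem IsRootFrame.frame_orthonormal (hEF : IsRootFrame T α E F)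
    (hh : ∀ i j, g0 d G (h i) (h j) = if i = j then 1 else 0) (i j : Fin k ⊕ Fin n ⊕ Fin n) :
    g0 d G (frame h E F i) (frame h E F j) = if i = j then 1 else 0 := by
  have hE : ∀ i j, g0 d G (h i) (E j) = 0 := fun i j => hEF.mem_perp (Or.inl ⟨j, rfl⟩) (h i)
  have hF : ∀ i j, g0 d G (h i) (F j) = 0 := fun i j => hEF.mem_perp (Or.inr ⟨j, rfl⟩) (h i)
  rcases i with i | i | i <;> rcases j with j | j | j <;>
    simp only [frame, Sum.elim_inl, Sum.elim_inr, Sum.inl.injEq, Sum.inr.injEq, reduceCtorEq,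
      if_false]
  · exact hh i j
  · exact hE i j
  · exact hF i j
  · rw [g0_symm]; exact hE j i
  · exact hEF.EE i j
  · exact hEF.EF i j
  · rw [g0_symm]; exact hF j i
  · rw [g0_symm]; exact hEF.EF j i
  · exact hEF.FF i j

/-- Subtracting from `v` its projection `w` to `𝔱` leaves a vector of `𝔱^⊥`, which the root frame
spans. -/
theorem IsRootFrame.top_le_span_frame (hEF : IsRootFrame T α E F)
    (hh : ∀ i j, g0 d G (h i) (h j) = if i = j then 1 else 0) :
    ⊤ ≤ Submodule.span ℝ (Set.range (frame h E F)) := by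
  intro v _
  set w : lieOf (d := d) T := ∑ i, g0 d G v (h i) • h i with hw
  have hwmem : ∀ u : lieOf (d := d) T, (u : LieAlg d G) ∈
      Submodule.span ℝ (Set.range (frame h E F)) := by
    intro u
    have h1 : u ∈ Submodule.span ℝ (Set.range h) := by rw [h.span_eq]; trivial
    have h2 := Submodule.mem_map_of_mem (f := (lieOf (d := d) T).subtype) h1
    rw [Submodule.map_span] at h2
    refine Submodule.span_mono ?_ h2
    rintro _ ⟨_, ⟨i, rfl⟩, rfl⟩
    exact ⟨Sum.inl i, rfl⟩
  have horth : v - w ∈ lieOfPerp (d := d) T := by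
    intro u hu
    have key : ∀ u : lieOf (d := d) T, g0 d G u (v - w) = 0 := by
      intro u
      have h1 : u ∈ Submodule.span ℝ (Set.range h) := by rw [h.span_eq]; trivial
      induction h1 using Submodule.span_induction with
      | mem x hx =>
        obtain ⟨i, rfl⟩ := hx
        have h2 : ((w : lieOf (d := d) T) : LieAlg d G) =
            ∑ i, g0 d G v (h i) • (h i : LieAlg d G) := by
          rw [hw]
          simp only [Submodule.coe_sum, Submodule.coe_smul]
        rw [map_sub, h2, map_sum]
        simp only [map_smul, hh]
        simp [g0_symm v]
      | zero => simp
      | add x y _ _ hx hy =>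
        rw [Submodule.coe_add, map_add, LinearMap.add_apply, hx, hy, add_zero]
      | smul c x _ hx => rw [Submodule.coe_smul, map_smul, LinearMap.smul_apply, hx, smul_zero]
    exact key ⟨u, hu⟩
  have h3 : v - w ∈ Submodule.span ℝ (Set.range (frame h E F)) := by
    rw [← hEF.span_eq] at horth
    refine Submodule.span_mono ?_ horth
    rintro _ (⟨i, rfl⟩ | ⟨i, rfl⟩)
    · exact ⟨Sum.inr (Sum.inl i), rfl⟩
    · exact ⟨Sum.inr (Sum.inr i), rfl⟩
  have h4 := Submodule.add_mem _ h3 (hwmem w)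
  rwa [sub_add_cancel] at h4

theorem IsRootFrame.sum_lieReal_sq (hEF : IsRootFrame T α E F)
    (hh : ∀ i j, g0 d G (h i) (h j) = if i = j then 1 else 0)
    (X : Module.Basis (Fin d) ℝ (LieAlg d G))
    (hX : ∀ i j, g0 d G (X i) (X j) = if i = j then 1 else 0) :
    ∑ i, lieReal (n := n) (X i) * lieReal (X i) =
      ∑ i, lieReal (h i : LieAlg d G) * lieReal (h i : LieAlg d G) +
        ∑ j, (lieReal (E j) * lieReal (E j) + lieReal (F j) * lieReal (F j)) := by
  rw [sum_mul_self_eq g0_symm hX X.span_eq.ge (hEF.frame_orthonormal hh)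
    (hEF.top_le_span_frame hh)]
  rw [Fintype.sum_sum_type, Fintype.sum_sum_type, Finset.sum_add_distrib]
  rfl

theorem IsRootFrame.lie_Zvec_Zbar (hEF : IsRootFrame T α E F)
    (hh : ∀ i j, g0 d G (h i) (h j) = if i = j then 1 else 0) (hα : ∀ j, α j ≠ 0) (j : Fin n) :
    ⁅Zvec E F j, Zbar E F j⁆ = (1 / 2 : ℂ) • dualVec h (α j) := by
  refine lie_root_neg_root (L := LieAlg d G) (B := g0 d G) g0_symm g0_lie
    (h := fun i => (h i : LieAlg d G)) (E := E) (F := F) (hEF.frame_orthonormal hh)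
    (hEF.top_le_span_frame hh) (Z := Zvec E F) (Z' := Zbar E F) (fun _ => rfl) (fun _ => rfl)
    (a := fun j i => α j (h i)) ?_ (fun i j => (hEF.rootZ j).2 (h i))
    (fun i j => (hEF.rootZbar j).2 (h i)) j
  intro j
  by_contra hc
  push Not at hc
  exact hα j (h.ext fun i => by simpa using hc i)

end Frame

/-- The Dolbeault operator `𝒟` on smooth fields. -/
def dolbeaultOp (E F : Fin n → LieAlg d G) : Module.End ℂ (SmoothField d G n) :=
  (4 * Complex.I) • ∑ a, sigOp E F (Zbar E F a) * lieOp (Zvec E F a)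

/-- The Dolbeault operator `𝒟̄` on smooth fields. -/
def dolbeaultBarOp (E F : Fin n → LieAlg d G) : Module.End ℂ (SmoothField d G n) :=
  (-4 * Complex.I) • ∑ b, sigOp E F (Zvec E F b) * lieOp (Zbar E F b)

/-- The operator `P` on smooth fields. -/
def POp (E F : Fin n → LieAlg d G) : Module.End ℂ (SmoothField d G n) :=
  (1 / 2 : ℂ) • (dolbeaultOp E F * dolbeaultBarOp E F - dolbeaultBarOp E F * dolbeaultOp E F)

theorem val_dolbeault (E F : Fin n → LieAlg d G) (Φ : SmoothField d G n) :
    (dolbeaultOp E F Φ).val d G n = dolbeault E F (Φ.val d G n) := by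
  simp only [dolbeaultOp, map_Zvec, map_Zbar]
  rw [← dirac_add_I_smul]
  simp only [dolbeault, dirac, diracTilde, LinearMap.add_apply, LinearMap.sub_apply,
    LinearMap.smul_apply, LinearMap.sum_apply, Module.End.mul_apply, map_add, map_sub, map_smul,
    map_sum, val_sigOp, val_lieOp]

theorem val_dolbeaultBar (E F : Fin n → LieAlg d G) (Φ : SmoothField d G n) :
    (dolbeaultBarOp E F Φ).val d G n = dolbeaultBar E F (Φ.val d G n) := by
  simp only [dolbeaultBarOp, map_Zvec, map_Zbar]
  rw [← dirac_sub_I_smul]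
  simp only [dolbeaultBar, dirac, diracTilde, LinearMap.add_apply, LinearMap.sub_apply,
    LinearMap.smul_apply, LinearMap.sum_apply, Module.End.mul_apply, map_add, map_sub, map_smul,
    map_sum, val_sigOp, val_lieOp]

theorem val_POp (E F : Fin n → LieAlg d G) (Φ : SmoothField d G n) :
    (POp E F Φ).val d G n = P E F (Φ.val d G n) := by
  rw [POp, LinearMap.smul_apply, LinearMap.sub_apply, Module.End.mul_apply, Module.End.mul_apply,
    map_smul, map_sub, val_dolbeault, val_dolbeaultBar, val_dolbeaultBar, val_dolbeault, P]

theorem val_sum_lieReal_sq {ι : Type*} [Fintype ι] (X : ι → LieAlg d G) (Φ : SmoothField d G n) :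
    ((∑ i, lieReal (X i) * lieReal (X i) : Module.End ℂ (SmoothField d G n)) Φ).val d G n =
      casimir X (Φ.val d G n) := by
  simp only [casimir, LinearMap.sum_apply, Module.End.mul_apply, map_sum, ← lieOp_toC, val_lieOp]

/-- Commutators of derivatives become brackets by `lieOp_lie`; the coefficient `4` of
`half_commutator` becomes `2` because `[Z_α, Z̄_α] = ½ H_α`. -/
theorem IsRootFrame.POp_eq {k : ℕ} {h : Module.Basis (Fin k) ℝ (lieOf (d := d) T)}
    (hEF : IsRootFrame T α E F) (hh : ∀ i j, g0 d G (h i) (h j) = if i = j then 1 else 0)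
    (hα : ∀ j, α j ≠ 0) (X : Module.Basis (Fin d) ℝ (LieAlg d G))
    (hX : ∀ i j, g0 d G (X i) (X j) = if i = j then 1 else 0) :
    POp E F = -(∑ i, lieReal (X i) * lieReal (X i)) +
      ∑ i, lieReal (h i : LieAlg d G) * lieReal (h i : LieAlg d G) +
      (2 : ℂ) • ∑ i, (sigOp E F (Zvec E F i) * (sigOp E F (Zbar E F i) * lieOp (dualVec h (α i))) +
        sigOp E F (Zbar E F i) * (sigOp E F (Zvec E F i) * lieOp (dualVec h (α i)))) -
      (8 : ℂ) • ∑ i, ∑ j ∈ Finset.univ.erase i, sigOp E F (Zvec E F i) *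
        (sigOp E F (Zbar E F j) * lieOp ⁅Zbar E F i, Zvec E F j⁆) := by
  rw [POp, dolbeaultOp, dolbeaultBarOp,
    half_commutator (le := fun j => lieReal (E j)) (lf := fun j => lieReal (F j))
    hEF.sigOp_Zbar_mul_sigOp_Zvec (fun _ _ => lieOp_commute_sigOp E F _ _)
    (fun _ _ => lieOp_commute_sigOp E F _ _) (fun j => by rw [map_Zvec, lieOp_toC, lieOp_toC])
    (fun j => by rw [map_Zbar, lieOp_toC, lieOp_toC]), hEF.sum_lieReal_sq hh X hX]
  simp only [← lieOp_lie, hEF.lie_Zvec_Zbar hh hα, map_smul, add_mul, mul_smul_comm, mul_assoc]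
  rw [← Finset.smul_sum, smul_smul]
  norm_num

theorem P_eq_of_isSmooth {k : ℕ} {h : Module.Basis (Fin k) ℝ (lieOf (d := d) T)}
    (hEF : IsRootFrame T α E F) (hh : ∀ i j, g0 d G (h i) (h j) = if i = j then 1 else 0)
    (hα : ∀ j, α j ≠ 0) (X : Module.Basis (Fin d) ℝ (LieAlg d G))
    (hX : ∀ i j, g0 d G (X i) (X j) = if i = j then 1 else 0) {Φ : G → Fun n}
    (hΦ : IsSmooth (d := d) Φ) :
    P E F Φ = -casimir X Φ + casimir (fun i => (h i : LieAlg d G)) Φ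
      + (2 : ℂ) • ∑ i,
          (sig E F (Zvec E F i) (sig E F (Zbar E F i) (lieD (dualVec h (α i)) Φ))
            + sig E F (Zbar E F i) (sig E F (Zvec E F i) (lieD (dualVec h (α i)) Φ)))
      - (8 : ℂ) • ∑ i, ∑ j ∈ Finset.univ.erase i,
          sig E F (Zvec E F i) (sig E F (Zbar E F j) (lieD ⁅Zbar E F i, Zvec E F j⁆ Φ)) := by
  let Φ' : SmoothField d G n := ⟨Φ, hΦ⟩
  have hval : Φ'.val d G n = Φ := rfl
  have key := congrArg (fun A => (A Φ').val d G n) (hEF.POp_eq hh hα X hX)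
  simp only [val_POp, LinearMap.add_apply, LinearMap.sub_apply, LinearMap.neg_apply,
    LinearMap.smul_apply, map_add, map_sub, map_neg, map_smul, val_sum_lieReal_sq] at key
  simpa only [LinearMap.sum_apply, LinearMap.add_apply, Module.End.mul_apply, map_add, map_sum,
    val_sigOp, val_lieOp, hval] using key

end Group

/-! ### The Gaussian vacuum -/

section Vacuum

variable {n : ℕ}

theorem hermiteFn_zero_apply (x : EuclideanSpace ℝ (Fin n)) :
    hermiteFn (fun _ : Fin n => 0) x = (Real.exp (-(1 / 2) * ‖x‖ ^ 2) : ℂ) := by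
  have h1 : ∀ t : ℝ, hermite 0 t = Real.exp (-(1 / 2) * t ^ 2) := by
    intro t
    rw [hermite, iteratedDeriv_zero, ← Real.exp_add]
    congr 1
    ring
  simp only [hermiteFn, h1]
  rw [← Real.exp_sum Finset.univ fun j => -(1 / 2) * x j ^ 2, ← Finset.mul_sum,
    EuclideanSpace.real_norm_sq_eq]

/-- Only `β = 0` has total degree zero, so the fibre is a line. The coefficient is `ψ 0` because the
Gaussian equals `1` at the origin. -/
theorem mem_Efib_zero_iff {ψ : Fun n} :
    ψ ∈ Efib n 0 ↔ ∀ x, ψ x = ψ 0 * hermiteFn (fun _ : Fin n => 0) x := by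
  have hset : {ψ : Fun n | ∃ β : Fin n → ℕ, ∑ j, β j = 0 ∧ ψ = hermiteFn β} =
      {hermiteFn (fun _ : Fin n => 0)} := by
    ext ψ
    simp only [Set.mem_ofPred_eq, Set.mem_singleton_iff]
    constructor
    · rintro ⟨β, hβ, rfl⟩
      congr 1
      funext j
      simpa using Finset.sum_eq_zero_iff.1 hβ j (Finset.mem_univ j)
    · rintro rfl
      exact ⟨fun _ => 0, by simp, rfl⟩
  rw [Efib, hset, Submodule.mem_span_singleton]
  constructor
  · rintro ⟨c, rfl⟩ x
    simp [hermiteFn_zero_apply]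
  · intro h
    exact ⟨ψ 0, funext fun x => (h x).symm⟩

theorem hasFDerivAt_hermiteFn_zero (x : EuclideanSpace ℝ (Fin n)) :
    HasFDerivAt (hermiteFn (fun _ : Fin n => 0))
      (-(hermiteFn (fun _ : Fin n => 0) x) • Complex.ofRealCLM.comp (innerSL ℝ x)) x := by
  have h1 : HasFDerivAt (fun y : EuclideanSpace ℝ (Fin n) => Real.exp (-(1 / 2) * ‖y‖ ^ 2))
      (Real.exp (-(1 / 2) * ‖x‖ ^ 2) • (-(1 / 2) : ℝ) • (2 : ℝ) • innerSL ℝ x) x := by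
    have h0 : HasFDerivAt (fun y : EuclideanSpace ℝ (Fin n) => ‖y‖ ^ 2)
        ((2 : ℝ) • innerSL ℝ x) x := by
      have := (hasStrictFDerivAt_norm_sq x).hasFDerivAt
      rwa [two_smul, ← two_smul ℝ] at this
    exact (h0.const_mul (-(1 / 2) : ℝ)).exp
  have h2 := Complex.ofRealCLM.hasFDerivAt.comp x h1
  have h3 : hermiteFn (fun _ : Fin n => 0) =
      Complex.ofRealCLM ∘ fun y : EuclideanSpace ℝ (Fin n) => Real.exp (-(1 / 2) * ‖y‖ ^ 2) :=
    funext hermiteFn_zero_apply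
  rw [h3]
  refine h2.congr_fderiv ?_
  ext v
  simp

theorem integral_conj_hermiteFn_zero_ne_zero :
    ∫ x : EuclideanSpace ℝ (Fin n), starRingEnd ℂ (hermiteFn (fun _ : Fin n => 0) x) *
      hermiteFn (fun _ : Fin n => 0) x ≠ 0 := by
  have h1 : ∀ x : EuclideanSpace ℝ (Fin n), starRingEnd ℂ (hermiteFn (fun _ : Fin n => 0) x) *
      hermiteFn (fun _ : Fin n => 0) x = ((Real.exp (-1 * ‖x‖ ^ 2) : ℝ) : ℂ) := by
    intro x
    rw [hermiteFn_zero_apply, Complex.conj_ofReal, ← Complex.ofReal_mul, ← Real.exp_add]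
    congr 2
    ring
  simp only [h1]
  rw [integral_complex_ofReal, GaussianFourier.integral_rexp_neg_mul_sq_norm one_pos]
  have : 0 < (Real.pi / 1) ^ ((Module.finrank ℝ (EuclideanSpace ℝ (Fin n)) : ℝ) / 2) :=
    Real.rpow_pos_of_pos (by positivity) _
  exact_mod_cast this.ne'

end Vacuum

/-! ### Sections of `E_0` -/

section Group

variable {d : ℕ} {G : Type*} [TopologicalSpace G] [ChartedSpace (EuclideanSpace ℝ (Fin d)) G]
  [Group G] [LieGroup (𝓡 d) ∞ G] {n : ℕ}
  {T : Subgroup G} {α : Fin n → Functional (d := d) T} {E F : Fin n → LieAlg d G}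

/-- `σ(Z̄_a)` is a multiple of `x_a + ∂_a`, and `∂_a` multiplies the Gaussian by `-x_a`. -/
theorem IsRootFrame.sigOp_Zbar_eq_zero (hEF : IsRootFrame T α E F) {Φ : SmoothField d G n}
    (hΦ : ∀ g, Φ.val d G n g ∈ Efib n 0) (a : Fin n) : sigOp E F (Zbar E F a) Φ = 0 := by
  rw [map_Zbar, hEF.sigOp_E, hEF.sigOp_F]
  ext g x
  have h1 := mem_Efib_zero_iff.1 (hΦ g)
  set c := Φ.val d G n g 0
  have h2 : Φ.val d G n g = fun x => c * hermiteFn (fun _ : Fin n => 0) x := funext h1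
  have h3 : partialX (EuclideanSpace.single a 1) (Φ.val d G n) g x =
      -((x a : ℂ) * Φ.val d G n g x) := by
    rw [partialX, h2, ((hasFDerivAt_hermiteFn_zero x).const_mul c).fderiv]
    simp [EuclideanSpace.inner_single_right]
    ring
  change (1 / 2 : ℂ) * (Complex.I * ((x a : ℂ) * Φ.val d G n g x) +
    Complex.I * partialX (EuclideanSpace.single a 1) (Φ.val d G n) g x) = 0
  rw [h3]
  ring

/-- The left side is `2 (σ(Z_j) σ(Z̄_j) + σ(Z̄_j) σ(Z_j))` applied to `Φ`. On the vacuum only the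
constant `-½` of the commutation relation survives. -/
theorem IsRootFrame.sigOp_sq_add_sigOp_sq (hEF : IsRootFrame T α E F) {Φ : SmoothField d G n}
    (hΦ : ∀ a, sigOp E F (Zbar E F a) Φ = 0) (j : Fin n) :
    sigOp E F (toC (E j)) (sigOp E F (toC (E j)) Φ) +
      sigOp E F (toC (F j)) (sigOp E F (toC (F j)) Φ) = -Φ := by
  have hE : sigOp E F (toC (E j)) = sigOp E F (Zvec E F j) + sigOp E F (Zbar E F j) := by
    rw [map_Zvec, map_Zbar]; module
  have hF : sigOp E F (toC (F j)) =
      Complex.I • (sigOp E F (Zvec E F j) - sigOp E F (Zbar E F j)) := by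
    rw [map_Zvec, map_Zbar]
    match_scalars <;> ring_nf
    simp
  have h1 := congrArg (fun A => A Φ) (hEF.sigOp_Zbar_mul_sigOp_Zvec j j)
  simp only [Module.End.mul_apply, LinearMap.sub_apply, hΦ, map_zero, if_true,
    LinearMap.smul_apply, Module.End.one_apply] at h1
  rw [hE, hF]
  simp only [LinearMap.add_apply, LinearMap.sub_apply, LinearMap.smul_apply, map_add, map_sub,
    map_smul, hΦ, h1, map_zero]
  match_scalars
  · linear_combination Complex.I_sq
  · linear_combination (1 / 2 : ℂ) * Complex.I_sq

/-- Each oscillator contributes its ground state value `½ α_j(H)`, and these add up to `ρ(H)`. -/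
theorem IsRootFrame.metaAd_eq (hEF : IsRootFrame T α E F) {Φ : SmoothField d G n}
    (hΦ : ∀ a, sigOp E F (Zbar E F a) Φ = 0) (H : lieOf (d := d) T) (g : G) :
    metaAd α E F H (Φ.val d G n g) = rho α H • Φ.val d G n g := by
  have h1 : ∀ j, sigma E F (toC (E j)) (sigma E F (toC (E j)) (Φ.val d G n g)) +
      sigma E F (toC (F j)) (sigma E F (toC (F j)) (Φ.val d G n g)) = -Φ.val d G n g := by
    intro j
    have := congrArg (fun Ψ => Ψ.val d G n g) (hEF.sigOp_sq_add_sigOp_sq hΦ j)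
    simp only [map_add, map_neg, val_sigOp] at this
    exact this
  simp only [metaAd, h1, rho]
  rw [← Finset.sum_smul, ← Finset.mul_sum, smul_smul, smul_smul, smul_neg, ← neg_smul]
  congr 1
  simp only [LinearMap.smul_apply, LinearMap.sum_apply, Complex.real_smul]
  push_cast
  linear_combination (-1 / 2 * ∑ j, α j H) * Complex.I_mul_I

theorem IsSmooth.translate {Φ : G → Fun n} (h : IsSmooth (d := d) Φ) (g : G) :
    IsSmooth (d := d) (fun u => Φ (g * u)) :=
  h.comp ((contMDiff_mul_left.comp contMDiff_fst).prodMk contMDiff_snd)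

theorem hasDerivAt_comp_expCurve {Φ : G → Fun n} (h : IsSmooth (d := d) Φ) {X : LieAlg d G}
    {γ : ℝ → G} (hγ : IsExpCurve X γ) (g : G) (x : EuclideanSpace ℝ (Fin n)) :
    HasDerivAt (fun s => Φ (g * γ s) x) (derivAt Φ g x X) 0 := by
  have h1 : MDifferentiableAt (𝓡 d) 𝓘(ℝ, ℂ) (fun u => Φ (g * u) x) (γ 0) :=
    ((h.translate g).left x).mdifferentiable (by simp) _
  let L : ℝ →L[ℝ] ℂ := (mfderiv (𝓡 d) 𝓘(ℝ, ℂ) (fun u => Φ (g * u) x) (γ 0)).comp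
    ((1 : ℝ →L[ℝ] ℝ).smulRight (mulInvariantVectorField X (γ 0)))
  have h2 : HasFDerivAt (fun s => Φ (g * γ s) x) L 0 :=
    (h1.hasMFDerivAt.comp 0 (hγ.2 0)).hasFDerivAt
  refine h2.hasDerivAt.congr_deriv ?_
  have h3 : derivAt Φ g x X = derivAt (fun u => Φ (g * u)) 1 x X := by
    rw [derivAt_eq_mfderiv h, derivAt_eq_mfderiv (h.translate g)]
    have : (fun u => Φ (g * (1 * u)) x) = fun u => Φ (g * u) x := by simp only [one_mul]
    exact (congrArg (fun f : G → ℂ => (mfderiv (𝓡 d) 𝓘(ℝ, ℂ) f 1 X : ℂ)) this).symm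
  rw [h3, ← hγ.1]
  change (mfderiv (𝓡 d) 𝓘(ℝ, ℂ) (fun u => Φ (g * u) x) (γ 0))
    ((1 : ℝ) • mulInvariantVectorField X (γ 0)) = _
  rw [one_smul]
  rfl

/-- On sections of `E_0` the torus acts by `-μ`. -/
theorem derivAt_eq_of_isExpCurve (hEF : IsRootFrame T α E F) {μ : Functional (d := d) T}
    {Φ : G → Fun n} (hΦ : IsSectionE T α E F μ 0 Φ) (H : lieOf (d := d) T) {γ : ℝ → G}
    (hγ : IsExpCurve (H : LieAlg d G) γ) (hT : ∀ s, γ s ∈ T) (g : G)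
    (x : EuclideanSpace ℝ (Fin n)) : derivAt Φ g x (H : LieAlg d G) = -(μ H) * Φ g x := by
  let Φ' : SmoothField d G n := ⟨Φ, hΦ.1.smooth⟩
  have hs : IsSmooth (d := d) Φ := hΦ.1.smooth
  have hvac : ∀ g x, Φ g x = Φ g 0 * hermiteFn (fun _ : Fin n => 0) x :=
    fun g => mem_Efib_zero_iff.1 (hΦ.2 g)
  have hkill : ∀ a, sigOp E F (Zbar E F a) Φ' = 0 := hEF.sigOp_Zbar_eq_zero (Φ := Φ') hΦ.2
  have hequi : ∀ s : ℝ, Φ (g * γ s) x = Complex.exp (-(s * μ H)) * Φ g x := by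
    -- Equivariance is known only through integrals against eigenfunctions. A nonzero value `Φ g₀`
    -- serves as the test function; if there is none, `Φ` vanishes identically.
    by_cases hzero : ∀ g, Φ g 0 = 0
    · intro s
      rw [hvac, hvac g, hzero, hzero]
      simp
    push Not at hzero
    obtain ⟨g₀, hg₀⟩ := hzero
    let θ : SchwartzMap (EuclideanSpace ℝ (Fin n)) ℂ :=
      { toFun := Φ g₀
        smooth' := hs.right g₀
        decay' := fun k m => by
          -- The empty list of derivatives gives the Schwartz bounds for `Φ` itself.
          obtain ⟨C, hC⟩ := hΦ.1.decay [] k m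
          exact ⟨C, fun x => hC g₀ x⟩ }
    have hint : ∀ g, ∫ x, starRingEnd ℂ (θ x) * Φ g x = starRingEnd ℂ (Φ g₀ 0) * Φ g 0 *
        ∫ x : EuclideanSpace ℝ (Fin n), starRingEnd ℂ (hermiteFn (fun _ : Fin n => 0) x) *
          hermiteFn (fun _ : Fin n => 0) x := by
      intro g
      rw [← MeasureTheory.integral_const_mul]
      refine MeasureTheory.integral_congr_ae (Filter.Eventually.of_forall fun x => ?_)
      have : θ x = Φ g₀ 0 * hermiteFn (fun _ : Fin n => 0) x := hvac g₀ x
      simp only [this, hvac g x, map_mul]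
      ring
    intro s
    -- The eigenvalue is `ρ(H)`, so the exponents `-(μ - ρ)` and `-ρ` combine to `-μ`.
    have key := hΦ.1.equivariant H γ hγ hT θ (rho α H) (hEF.metaAd_eq hkill H g₀) g s
    rw [hint, hint, ← Complex.exp_add] at key
    have hne := integral_conj_hermiteFn_zero_ne_zero (n := n)
    have hne' : starRingEnd ℂ (Φ g₀ 0) ≠ 0 := by simpa using hg₀
    have h4 : Φ (g * γ s) 0 = Complex.exp (-(s * μ H)) * Φ g 0 := by
      have he : -((s : ℂ) * (μ H - rho α H)) + -(s * rho α H) = -(s * μ H) := by ring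
      rw [he] at key
      refine mul_left_cancel₀ (mul_ne_zero hne' hne) ?_
      linear_combination key
    rw [hvac, h4, hvac g x]
    ring
  have h1 := hasDerivAt_comp_expCurve hs hγ g x
  simp only [hequi] at h1
  have h2 : HasDerivAt (fun s : ℝ => Complex.exp (-(s * μ H)) * Φ g x) (-(μ H) * Φ g x) 0 := by
    have h3 : HasDerivAt (fun s : ℝ => -((s : ℂ) * μ H)) (-(1 * μ H)) 0 :=
      ((Complex.ofRealCLM.hasDerivAt (x := 0)).mul_const (μ H)).neg
    simpa using (h3.cexp.mul_const (Φ g x))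
  exact h1.unique h2

/-- `lieOf` is a span, so the result for generators of one-parameter subgroups in `T` extends by
linearity. -/
theorem lieReal_eq_neg_smul (hEF : IsRootFrame T α E F) {μ : Functional (d := d) T}
    {Φ : SmoothField d G n} (hΦ : IsSectionE T α E F μ 0 (Φ.val d G n))
    (H : lieOf (d := d) T) : lieReal (H : LieAlg d G) Φ = -(μ H) • Φ := by
  obtain ⟨X, hX⟩ := H
  induction hX using Submodule.span_induction with
  | mem X hX =>
    obtain ⟨γ, hγ, hT⟩ := hX
    ext g x
    exact derivAt_eq_of_isExpCurve hEF hΦ ⟨X, Submodule.subset_span ⟨γ, hγ, hT⟩⟩ hγ hT g x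
  | zero =>
    have h0 : μ ⟨0, Submodule.zero_mem _⟩ = 0 := map_zero μ
    rw [h0]
    simp
  | add X Y hX hY h1 h2 =>
    have h0 : μ ⟨X + Y, Submodule.add_mem _ hX hY⟩ = μ ⟨X, hX⟩ + μ ⟨Y, hY⟩ :=
      map_add μ ⟨X, hX⟩ ⟨Y, hY⟩
    rw [h0]
    change lieReal (X + Y) _ = _
    rw [map_add, LinearMap.add_apply]
    simp only at h1 h2
    rw [h1, h2]
    module
  | smul c X hX h1 =>
    have h0 : μ ⟨c • X, Submodule.smul_mem _ c hX⟩ = c • μ ⟨X, hX⟩ := map_smul μ c ⟨X, hX⟩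
    rw [h0]
    change lieReal (c • X) _ = _
    simp only at h1
    rw [map_smul, LinearMap.smul_apply, h1]
    match_scalars
    simp [Complex.real_smul]

section Weight

variable {k : ℕ} {h : Module.Basis (Fin k) ℝ (lieOf (d := d) T)}

theorem weightForm_eq (hh : ∀ i j, g0 d G (h i) (h j) = if i = j then 1 else 0)
    (l ν : Functional (d := d) T) : weightForm h l ν = ∑ i, l (h i) * ν (h i) := by
  simp only [weightForm, dualVec, map_sum, map_smul, LinearMap.sum_apply, LinearMap.smul_apply,
    g0C_toC, hh]
  refine Finset.sum_congr rfl fun i _ => ?_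
  rw [smul_eq_mul, mul_comm]
  congr 1
  refine (Finset.sum_eq_single i (fun j _ hj => ?_) (by simp)).trans ?_ <;> simp [*]

theorem P_eq_of_isSectionE_zero (hEF : IsRootFrame T α E F)
    (hh : ∀ i j, g0 d G (h i) (h j) = if i = j then 1 else 0) (hα : ∀ j, α j ≠ 0)
    (X : Module.Basis (Fin d) ℝ (LieAlg d G))
    (hX : ∀ i j, g0 d G (X i) (X j) = if i = j then 1 else 0) {μ : Functional (d := d) T}
    {Φ : G → Fun n} (hΦ : IsSectionE T α E F μ 0 Φ) :
    P E F Φ = -casimir X Φ + (weightForm h μ μ + 2 * weightForm h (rho α) μ) • Φ := by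
  set Φ' : SmoothField d G n := ⟨Φ, hΦ.1.smooth⟩ with hΦ'
  have hval : Φ'.val d G n = Φ := rfl
  have hkill : ∀ a, sigOp E F (Zbar E F a) Φ' = 0 := hEF.sigOp_Zbar_eq_zero (Φ := Φ') hΦ.2
  -- Derivatives commute with `σ(Z̄_a)`, so a derivative of a vacuum section is still annihilated.
  have hkill' : ∀ a Y, sigOp E F (Zbar E F a) (lieOp Y Φ') = 0 := by
    intro a Y
    have := congrArg (fun A => A Φ') (lieOp_commute_sigOp E F Y (Zbar E F a)).eq
    simp only [Module.End.mul_apply, hkill, map_zero] at this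
    exact this.symm
  have hH : ∀ i, lieReal (h i : LieAlg d G) Φ' = -(μ (h i)) • Φ' :=
    fun i => lieReal_eq_neg_smul (Φ := Φ') hEF hΦ (h i)
  have hdual : ∀ l : Functional (d := d) T,
      lieOp (dualVec h l) Φ' = -(weightForm h l μ) • Φ' := by
    intro l
    simp only [dualVec, map_sum, map_smul, lieOp_toC, LinearMap.sum_apply, LinearMap.smul_apply,
      hH, weightForm_eq hh, smul_smul, ← Finset.sum_smul, ← Finset.sum_neg_distrib, mul_neg]
  -- The factor `-½` from the commutation relation meets `-g₀(α_i, μ)` from the action of `H_α`.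
  have h1 : ∀ i, sigOp E F (Zbar E F i) (sigOp E F (Zvec E F i) (lieOp (dualVec h (α i)) Φ')) =
      (1 / 2 * weightForm h (α i) μ) • Φ' := by
    intro i
    have := congrArg (fun A => A (lieOp (dualVec h (α i)) Φ')) (hEF.sigOp_Zbar_mul_sigOp_Zvec i i)
    simp only [Module.End.mul_apply, LinearMap.sub_apply, hkill', map_zero, if_true,
      LinearMap.smul_apply, Module.End.one_apply] at this
    rw [this, hdual]
    module
  have hρ : ∑ i, weightForm h (α i) μ = 2 * weightForm h (rho α) μ := by
    simp only [weightForm_eq hh, rho, LinearMap.smul_apply, LinearMap.sum_apply,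
      Complex.real_smul]
    rw [Finset.sum_comm, Finset.mul_sum]
    refine Finset.sum_congr rfl fun i _ => ?_
    rw [← Finset.sum_mul]
    push_cast
    ring
  have key := congrArg (fun A => A Φ') (hEF.POp_eq hh hα X hX)
  have h2 : (∑ i, lieReal (h i : LieAlg d G) * lieReal (h i : LieAlg d G) :
      Module.End ℂ (SmoothField d G n)) Φ' = weightForm h μ μ • Φ' := by
    simp only [LinearMap.sum_apply, Module.End.mul_apply, hH, map_smul, weightForm_eq hh,
      smul_smul, ← Finset.sum_smul, neg_mul_neg]
  simp only [LinearMap.add_apply, LinearMap.sub_apply, LinearMap.neg_apply,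
    LinearMap.smul_apply, h2] at key
  have h3 : (2 : ℂ) • (∑ i, (sigOp E F (Zvec E F i) * (sigOp E F (Zbar E F i) *
        lieOp (dualVec h (α i))) + sigOp E F (Zbar E F i) * (sigOp E F (Zvec E F i) *
        lieOp (dualVec h (α i)))) : Module.End ℂ (SmoothField d G n)) Φ' =
      (2 * weightForm h (rho α) μ) • Φ' := by
    simp only [LinearMap.sum_apply, LinearMap.add_apply, Module.End.mul_apply, hkill', map_zero,
      h1, zero_add, ← Finset.sum_smul, ← Finset.mul_sum, hρ, smul_smul]
    congr 1
    ring
  have h4 : (∑ i, ∑ j ∈ Finset.univ.erase i, sigOp E F (Zvec E F i) *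
        (sigOp E F (Zbar E F j) * lieOp ⁅Zbar E F i, Zvec E F j⁆) :
        Module.End ℂ (SmoothField d G n)) Φ' = 0 := by
    simp only [LinearMap.sum_apply, Module.End.mul_apply, hkill', map_zero,
      Finset.sum_const_zero]
  rw [h3, h4, smul_zero, sub_zero, add_assoc, ← add_smul] at key
  have := congrArg (fun Ψ => Ψ.val d G n) key
  simpa only [map_add, map_neg, map_smul, val_POp, val_sum_lieReal_sq, hval] using this

end Weight

end Group
end
end FlagDirac

theorem mainTheorem4
    {d : ℕ} {G : Type*} [TopologicalSpace G] [T2Space G] [CompactSpace G] [SimplyConnectedSpace G]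
    [ChartedSpace (EuclideanSpace ℝ (Fin d)) G] [Group G] [LieGroup (𝓡 d) ∞ G]
    [LieAlgebra.IsSemisimple ℝ (FlagDirac.LieAlg d G)]
    (T : Subgroup G) (hT : FlagDirac.IsMaximalTorus T)
    {n : ℕ} (α : Fin n → FlagDirac.Functional (d := d) T) (hα : FlagDirac.IsPositiveSystem T α)
    (E F : Fin n → FlagDirac.LieAlg d G) (hEF : FlagDirac.IsRootFrame T α E F)
    (X : Module.Basis (Fin d) ℝ (FlagDirac.LieAlg d G))
    (hX : ∀ i j, FlagDirac.g0 d G (X i) (X j) = if i = j then 1 else 0)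
    {k : ℕ} (h : Module.Basis (Fin k) ℝ (FlagDirac.lieOf (d := d) T))
    (hh : ∀ i j, FlagDirac.g0 d G (h i) (h j) = if i = j then 1 else 0)
    (μ : FlagDirac.Functional (d := d) T) (hμ : FlagDirac.IsWeight T μ) :
    (∀ Φ : G → FlagDirac.Fun n, FlagDirac.IsSection T α E F μ Φ →
      FlagDirac.P E F Φ =
        -FlagDirac.casimir X Φ + FlagDirac.casimir (fun i => (h i : FlagDirac.LieAlg d G)) Φ
        + (2 : ℂ) • ∑ i,
            (FlagDirac.sig E F (FlagDirac.Zvec E F i) (FlagDirac.sig E F (FlagDirac.Zbar E F i)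
                (FlagDirac.lieD (FlagDirac.dualVec h (α i)) Φ))
              + FlagDirac.sig E F (FlagDirac.Zbar E F i) (FlagDirac.sig E F (FlagDirac.Zvec E F i)
                (FlagDirac.lieD (FlagDirac.dualVec h (α i)) Φ)))
        - (8 : ℂ) • ∑ i, ∑ j ∈ Finset.univ.erase i,
            FlagDirac.sig E F (FlagDirac.Zvec E F i) (FlagDirac.sig E F (FlagDirac.Zbar E F j)
              (FlagDirac.lieD ⁅FlagDirac.Zbar E F i, FlagDirac.Zvec E F j⁆ Φ))) ∧
    (∀ Φ : G → FlagDirac.Fun n, FlagDirac.IsSectionE T α E F μ 0 Φ →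
      FlagDirac.P E F Φ =
        -FlagDirac.casimir X Φ
          + (FlagDirac.weightForm h μ μ + 2 * FlagDirac.weightForm h (FlagDirac.rho α) μ) • Φ ∧
      FlagDirac.P E F Φ =
        -FlagDirac.casimir X Φ
          + (FlagDirac.weightForm h (μ + FlagDirac.rho α) (μ + FlagDirac.rho α)
              - FlagDirac.weightForm h (FlagDirac.rho α) (FlagDirac.rho α)) • Φ) := by
  have hα0 : ∀ j, α j ≠ 0 := fun j => (hα.isRoot j).1
  refine ⟨fun Φ hΦ => FlagDirac.P_eq_of_isSmooth hEF hh hα0 X hX hΦ.smooth, fun Φ hΦ => ?_⟩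
  have h1 := FlagDirac.P_eq_of_isSectionE_zero hEF hh hα0 X hX hΦ
  refine ⟨h1, h1.trans ?_⟩
  -- Completing the square: `‖μ + ρ‖² - ‖ρ‖² = ‖μ‖² + 2 g₀(ρ, μ)`, checked coordinatewise in the
  -- basis `h`.
  congr 2
  simp only [FlagDirac.weightForm_eq hh, LinearMap.add_apply, Finset.mul_sum,
    ← Finset.sum_add_distrib, ← Finset.sum_sub_distrib]
  refine Finset.sum_congr rfl fun i _ => ?_
  ring
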